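/- Let $N_S\subset \mathrm{SL}_2$ be the subgroup generated by the diagonal torus $\{\mathrm{diag}(t,t^{-1})\}\cong\mathbb{G}_m$ and $\sigma=\begin{pmatrix}0&1\\-1&0\end{pmatrix}$. Let $a,b$ be odd integers and let $N_S$ act on $\mathbb{P}^3=\mathbb{P}^3_{\mathbb{R}}$ by $\mathrm{diag}(t,t^{-1})\cdot[X_0:X_1:X_2:X_3]=[t^aX_0:t^{-a}X_1:t^bX_2:t^{-b}X_3]$ and $\sigma\cdot[X_0:X_1:X_2:X_3]=[-X_1:X_0:-X_3:X_2]$. For a representation $V$ of $\mathbb{G}_m$ that is the direct sum of its weight spaces $V_m=\{v: t\cdot v=t^mv\}$, with $V$ of finite dimension over $\mathbb{R}$, write $\mathrm{tr}_V(t)=\sum_m \dim(V_m)\,t^m\in\mathbb{Z}[t,t^{-1}]$. Let $\mathcal{I}\subset\mathcal{O}_{\mathbb{P}^3}$ be an $N_S$-stable ideal sheaf of a closed subscheme that is finite over $\mathbb{R}$ (that is, $[\mathcal I]\in \mathrm{Hilb}^n(\mathbb{P}^3)$ for some $n$). Let $i\in\{0,\dots,3\}$ and $U_i=\{X_i\ne0\}$.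 Write $R=\mathbb{R}[x,y,z]\cong H^0(U_i,\mathcal{O}_{\mathbb{P}^3})$, where $x,y,z$ are the coordinates $X_j/X_i$, $j\neq i$, in increasing order of $j$. Let $I\subset R$ be the ideal defined by $\mathcal{I}$ on $U_i$. The torus acts on $R$ by $t\cdot(x,y,z)=(s_1x,s_2y,s_3z)$, where $s_1,s_2,s_3$ are the tangent weights on $U_i$: if $X_j$ has weight $e_j$, $(e_0,e_1,e_2,e_3)=(a,-a,b,-b)$, then the tangent weight of $X_j/X_i$ is $t^{e_j-e_i}$. Then $I$ is stable under the torus, the induced representations of the torus on $R/I$, $\mathrm{Ext}^1_R(I,I)$ and $\mathrm{Ext}^2_R(I,I)$ are finite-dimensional and are direct sums of their weight spaces, and, with $Q(t)=\mathrm{tr}_{R/I}(t)$, $$\mathrm{tr}_{\mathrm{Ext}^1_R(I,I)}(t)-\mathrm{tr}_{\mathrm{Ext}^2_R(I,I)}(t)=\frac{s_1s_2s_3\,Q(t)-Q(t^{-1})+Q(t)\,Q(t^{-1})(1-s_1)(1-s_2)(1-s_3)}{s_1s_2s_3}$$ in $\mathbb{Z}[t,t^{-1}]$. If moreover $I$ is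 a monomial ideal, then the set $\pi_I=\{(k_1,k_2,k_3)\in\mathbb{N}^3: x^{k_1}y^{k_2}z^{k_3}\notin I\}$ is finite and $Q(t)=\sum_{(k_1,k_2,k_3)\in\pi_I}s_1^{k_1}s_2^{k_2}s_3^{k_3}$. -/

import Mathlib

open CategoryTheory AlgebraicGeometry MvPolynomial
open scoped LaurentPolynomial MatrixGroups HomogeneousIdeal

noncomputable section

namespace NSTrace

/-! ### The group `N_S` and its representation on `ℝ⁴` -/

/-- The diagonal matrix `diag(t, t⁻¹)`. -/
def diagSL (t : ℝˣ) : SL(2, ℝ) :=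
  ⟨!![(t : ℝ), 0; 0, (t : ℝ)⁻¹], by simp [Matrix.det_fin_two]⟩

/-- The matrix `σ`. -/
def sigmaSL : SL(2, ℝ) :=
  ⟨!![0, 1; -1, 0], by simp [Matrix.det_fin_two]⟩

/-- `N_S`: the subgroup of `SL₂` generated by the diagonal torus and `σ`. -/
def NS : Subgroup SL(2, ℝ) :=
  Subgroup.closure (Set.range diagSL ∪ {sigmaSL})

/-- The block matrix with blocks `(g_ij ^ a)` and `(g_ij ^ b)`.  It sends `diag(t, t⁻¹)` to
`diag(t ^ a, t ^ (-a), t ^ b, t ^ (-b))` and, for odd `a`, `b`, it sends `σ` to the block matrix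
with blocks `σ`, `σ`. -/
def blockMatrix (a b : ℤ) (g : SL(2, ℝ)) : Matrix (Fin 4) (Fin 4) ℝ :=
  !![g.1 0 0 ^ a, g.1 0 1 ^ a, 0, 0;
     g.1 1 0 ^ a, g.1 1 1 ^ a, 0, 0;
     0, 0, g.1 0 0 ^ b, g.1 0 1 ^ b;
     0, 0, g.1 1 0 ^ b, g.1 1 1 ^ b]

/-- Elements of `N_S` are diagonal or antidiagonal. -/
lemma NS_cases {g : SL(2, ℝ)} (hg : g ∈ NS) :
    (g.1 0 1 = 0 ∧ g.1 1 0 = 0) ∨ (g.1 0 0 = 0 ∧ g.1 1 1 = 0) := by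
  induction hg using Subgroup.closure_induction with
  | mem x hx =>
    rcases hx with ⟨t, rfl⟩ | rfl
    · left; simp [diagSL]
    · right; simp [sigmaSL]
  | one => left; simp
  | mul x y _ _ hx hy =>
    simp only [Matrix.SpecialLinearGroup.coe_mul, Matrix.mul_apply, Fin.sum_univ_two]
    rcases hx with hx | hx <;> rcases hy with hy | hy <;> simp [hx, hy]
  | inv x _ hx =>
    rw [Matrix.SpecialLinearGroup.SL2_inv_expl]
    rcases hx with hx | hx <;> simp [hx]

/-- The representation of `N_S` on `ℝ⁴` with parameters `a`, `b` (in row vectors). -/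
def repMatrix (a b : ℤ) (ha : Odd a) (hb : Odd b) : NS →* Matrix (Fin 4) (Fin 4) ℝ where
  toFun g := blockMatrix a b g.1
  map_one' := by
    have ha0 : a ≠ 0 := by rintro rfl; simp at ha
    have hb0 : b ≠ 0 := by rintro rfl; simp at hb
    ext i j
    fin_cases i <;> fin_cases j <;> simp [blockMatrix, zero_zpow _ ha0, zero_zpow _ hb0]
  map_mul' g h := by
    have ha0 : a ≠ 0 := by rintro rfl; simp at ha
    have hb0 : b ≠ 0 := by rintro rfl; simp at hb
    ext i j
    rcases NS_cases g.2 with hg | hg <;> rcases NS_cases h.2 with hh | hh <;>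
      fin_cases i <;> fin_cases j <;>
      simp [blockMatrix, Matrix.mul_apply, Fin.sum_univ_four, Fin.sum_univ_two, hg, hh, mul_zpow,
        zero_zpow _ ha0, zero_zpow _ hb0]

/-- The same representation with values in `GL₄`. -/
def repGL (a b : ℤ) (ha : Odd a) (hb : Odd b) : NS →* GL (Fin 4) ℝ :=
  (repMatrix a b ha hb).toHomUnits

/-! ### Projective space with its `N_S`-action, and its ideal sheaves -/

/-- The homogeneous coordinate ring `ℝ[X₀, X₁, X₂, X₃]` with its grading by degree. -/
abbrev grS : ℕ → Submodule ℝ (MvPolynomial (Fin 4) ℝ) := homogeneousSubmodule (Fin 4) ℝ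

instance : GradedAlgebra grS := MvPolynomial.gradedAlgebra

/-- The projective space `ℙ³` over `ℝ`. -/
abbrev PThree : Scheme.{0} := Proj grS

/-- The substitution `X_j ↦ ∑ i, M i j * X_i`, that is, `f ↦ (v ↦ f (v * M))` for row vectors
`v`, as a graded homomorphism. -/
def linSubst (M : Matrix (Fin 4) (Fin 4) ℝ) : grS →+*ᵍ grS where
  __ := (aeval (fun j => ∑ i, C (M i j) * X i) :
    MvPolynomial (Fin 4) ℝ →ₐ[ℝ] MvPolynomial (Fin 4) ℝ).toRingHom
  map_mem {n f} hf := by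
    have hf' : f.IsHomogeneous n := hf
    have h := hf'.aeval (fun j => ∑ i, C (M i j) * X i : Fin 4 → MvPolynomial (Fin 4) ℝ)
      (n := 1) (fun j => IsHomogeneous.sum _ _ _ fun i _ => by
        simpa using (isHomogeneous_C (Fin 4) (M i j)).mul (isHomogeneous_X ℝ i))
    rw [one_mul] at h
    exact h

lemma linSubst_apply (M : Matrix (Fin 4) (Fin 4) ℝ) (f : MvPolynomial (Fin 4) ℝ) :
    linSubst M f = aeval (fun j => ∑ i, C (M i j) * X i) f := rfl

lemma linSubst_mul_inv (g : GL (Fin 4) ℝ) (f : MvPolynomial (Fin 4) ℝ) :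
    linSubst g.1 (linSubst (g⁻¹).1 f) = f := by
  have h : (aeval (fun j => ∑ i, C (g.1 i j) * X i)).comp
      (aeval (fun j => ∑ i, C ((g⁻¹).1 i j) * X i)) =
      AlgHom.id ℝ (MvPolynomial (Fin 4) ℝ) := by
    ext1 j
    have hM : g.1 * (g⁻¹).1 = 1 := by rw [← Units.val_mul, mul_inv_cancel, Units.val_one]
    have hij : ∀ i, ∑ k, g.1 i k * (g⁻¹).1 k j = if i = j then 1 else 0 := by
      intro i
      rw [← Matrix.mul_apply, hM, Matrix.one_apply]
    simp only [AlgHom.comp_apply, aeval_X, map_sum, map_mul, algHom_C, AlgHom.id_apply,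
      Finset.mul_sum, algebraMap_eq]
    rw [Finset.sum_comm]
    calc _ = ∑ i, C (∑ k, g.1 i k * (g⁻¹).1 k j) * (X i : MvPolynomial (Fin 4) ℝ) := by
          refine Finset.sum_congr rfl fun i _ => ?_
          rw [map_sum, Finset.sum_mul]
          refine Finset.sum_congr rfl fun k _ => ?_
          rw [map_mul]; ring
      _ = X j := by
          simp only [hij]
          simp [Finset.sum_eq_single j]
  exact DFunLike.congr_fun h f

lemma irrelevant_le_map_linSubst (g : GL (Fin 4) ℝ) :
    grS₊ ≤ (grS₊).map (linSubst g.1) := by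
  rw [HomogeneousIdeal.irrelevant_le]
  intro n hn f hf
  have hf' : f ∈ grS n := hf
  have h := Ideal.mem_map_of_mem (linSubst g.1)
    (HomogeneousIdeal.mem_irrelevant_of_mem (𝒜 := grS) hn ((linSubst (g⁻¹).1).map_mem hf'))
  rw [← linSubst_mul_inv g f]
  exact h

/-- The automorphism `v ↦ v * g` of `ℙ³` (in row vectors). -/
def projAut (g : GL (Fin 4) ℝ) : PThree ⟶ PThree :=
  Proj.map (linSubst g.1) (irrelevant_le_map_linSubst g)

/-- The ideal sheaf `I` on `ℙ³` is stable under the action of `N_S` with parameters `a`, `b`. -/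
def IsNSStable (a b : ℤ) (ha : Odd a) (hb : Odd b) (I : PThree.IdealSheafData) : Prop :=
  ∀ g : NS, I.comap (projAut (repGL a b ha hb g)) = I

/-- The closed subscheme of `ℙ³` defined by `I` is finite over the base field, that is, `I` is
a real point of `Hilbⁿ(ℙ³)` for some `n`. -/
def HasFiniteColength (I : PThree.IdealSheafData) : Prop :=
  IsFinite (I.subschemeι ≫ Proj.toSpecZero grS)

/-! ### The standard affine charts -/

/-- The coordinate ring `R = ℝ[x, y, z]` of a standard chart. -/
abbrev R : Type := MvPolynomial (Fin 3) ℝ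

/-- The standard affine open `U_i = {X_i ≠ 0}`. -/
def chart (i : Fin 4) : PThree.affineOpens :=
  ⟨Proj.basicOpen grS (X i),
    Proj.isAffineOpen_basicOpen grS (X i) (isHomogeneous_X ℝ i) one_pos⟩

/-- The ring homomorphism `ℝ[x, y, z] → H⁰(U_i, 𝒪)` (an isomorphism) sending the three variables to the functions
`X_j / X_i`, `j ≠ i`, in increasing order of `j`. -/
def chartCoord (i : Fin 4) : R →+* Γ(PThree, (chart i).1) :=
  (Proj.awayToSection grS (X i)).hom.comp
    (eval₂Hom ((HomogeneousLocalization.fromZeroRingHom grS (Submonoid.powers (X i))).comp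
        (algebraMap ℝ (grS 0)))
      fun j : Fin 3 => HomogeneousLocalization.Away.mk grS
        (isHomogeneous_X ℝ i : X i ∈ grS 1) 1 (X (i.succAbove j))
        (isHomogeneous_X ℝ (i.succAbove j)))

/-- The ideal of `R` given by the ideal sheaf `I` on the chart `U_i`. -/
def chartIdeal (I : PThree.IdealSheafData) (i : Fin 4) : Ideal R :=
  (I.ideal (chart i)).comap (chartCoord i)

/-- The weights of the torus on `X₀, X₁, X₂, X₃`. -/
def homWeight (a b : ℤ) : Fin 4 → ℤ := ![a, -a, b, -b]

/-- The exponents `w` of the tangent weights `s_j = t ^ (w j)` on the chart `U_i`. -/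
def tangentWeight (a b : ℤ) (i : Fin 4) (j : Fin 3) : ℤ :=
  homWeight a b (i.succAbove j) - homWeight a b i

/-! ### Weight spaces and traces of torus representations -/

section Trace

variable {V : Type} [AddCommGroup V] [Module ℝ V]

/-- The weight space `V_m`. -/
def weightSpace (ρ : ℝˣ → V →ₗ[ℝ] V) (m : ℤ) : Submodule ℝ V :=
  ⨅ t : ℝˣ, LinearMap.ker (ρ t - ((t : ℝ) ^ m) • LinearMap.id)

lemma mem_weightSpace (ρ : ℝˣ → V →ₗ[ℝ] V) (m : ℤ) (v : V) :
    v ∈ weightSpace ρ m ↔ ∀ t : ℝˣ, ρ t v = ((t : ℝ) ^ m) • v := by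
  simp [weightSpace, sub_eq_zero]

/-- `ρ` is a finite-dimensional (algebraic) representation of `𝔾_m`: it is the direct sum of its
weight spaces. -/
def IsFiniteTorusRep (ρ : ℝˣ → V →ₗ[ℝ] V) : Prop :=
  FiniteDimensional ℝ V ∧ DirectSum.IsInternal (weightSpace ρ)

/-- The trace `∑ m, dim V_m * t ^ m`, as a Laurent polynomial in `t`. -/
def tr (ρ : ℝˣ → V →ₗ[ℝ] V) : ℤ[T;T⁻¹] :=
  ∑ᶠ m : ℤ, LaurentPolynomial.C (Module.finrank ℝ (weightSpace ρ m) : ℤ) * LaurentPolynomial.T m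

end Trace

/-- A map `g : M → N` with `g (f r • m) = r • g m`, as a linear map on the restriction of scalars
of `M` along `f`. -/
def ofRestrictScalars {A B : Type} [Ring A] [Ring B] (f : A →+* B) (M : ModuleCat.{0} B)
    (N : ModuleCat.{0} A) (g : M →+ N) (hg : ∀ (r : A) (m : M), g (f r • m) = r • g m) :
    (ModuleCat.restrictScalars f).obj M ⟶ N :=
  ModuleCat.ofHom (X := (ModuleCat.restrictScalars f).obj M)
    { toFun := g
      map_add' := map_add g
      map_smul' := hg }

/-! ### The torus action on `R`, on `R / I` and on `Ext(I, I)` -/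

section Torus

variable (w : Fin 3 → ℤ)

/-- The action of `t` on `R`, with `t • (x, y, z) = (s₁ x, s₂ y, s₃ z)` and `s_j = t ^ (w j)`. -/
def torusAct (t : ℝˣ) : R →ₐ[ℝ] R :=
  aeval fun j => C ((t : ℝ) ^ w j) * X j

lemma torusAct_mul_inv (t : ℝˣ) (f : R) : torusAct w t (torusAct w t⁻¹ f) = f := by
  have h : (torusAct w t).comp (torusAct w t⁻¹) = AlgHom.id ℝ R := by
    ext1 j
    have ht : ((t : ℝ) ^ w j) ≠ 0 := zpow_ne_zero _ t.ne_zero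
    simp only [torusAct, AlgHom.comp_apply, aeval_X, map_mul, algHom_C, AlgHom.id_apply,
      algebraMap_eq, ← mul_assoc, ← C_mul, Units.val_inv_eq_inv_val, inv_zpow,
      inv_mul_cancel₀ ht, C_1, one_mul]
  exact DFunLike.congr_fun h f

/-- The ideal `I` is stable under the torus. -/
def IsTorusStable (I : Ideal R) : Prop :=
  ∀ t : ℝˣ, ∀ f ∈ I, torusAct w t f ∈ I

variable {w} {I : Ideal R} (hI : IsTorusStable w I)

/-- The action of the torus on `R / I`. -/
def quotAct (t : ℝˣ) : (R ⧸ I) →ₗ[ℝ] (R ⧸ I) :=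
  (Ideal.quotientMapₐ I (torusAct w t) (fun f hf => hI t f hf)).toLinearMap

variable (w) in
/-- Restriction of scalars along the action of `t` on `R`. -/
abbrev twist (t : ℝˣ) : ModuleCat.{0} R ⥤ ModuleCat.{0} R :=
  ModuleCat.restrictScalars (torusAct w t).toRingHom

/-- The action of `t` on `I`, as a semilinear map. -/
def idealAct (t : ℝˣ) : I →ₛₗ[(torusAct w t).toRingHom] I where
  toFun f := ⟨torusAct w t f.1, hI t f.1 f.2⟩
  map_add' f g := Subtype.ext (map_add (torusAct w t) f.1 g.1)
  map_smul' r f := Subtype.ext (map_mul (torusAct w t) r f.1)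

lemma idealAct_inv_smul (t : ℝˣ) (r : R) (f : I) :
    idealAct hI t⁻¹ (torusAct w t r • f) = r • idealAct hI t⁻¹ f := by
  have h := torusAct_mul_inv w t⁻¹ r
  rw [inv_inv] at h
  rw [LinearMap.map_smulₛₗ]
  exact congrArg (· • idealAct hI t⁻¹ f) h

/-- The action of `t` on `I`, as an `R`-linear map from `I` to the twist of `I` by `t`. -/
def toTwist (t : ℝˣ) : ModuleCat.of R I ⟶ (twist w t).obj (ModuleCat.of R I) :=
  ModuleCat.semilinearMapAddEquiv (torusAct w t).toRingHom (ModuleCat.of R I) (ModuleCat.of R I)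
    (idealAct hI t)

/-- The inverse of `toTwist`: the action of `t⁻¹` on `I`. -/
def fromTwist (t : ℝˣ) : (twist w t).obj (ModuleCat.of R I) ⟶ ModuleCat.of R I :=
  ofRestrictScalars (torusAct w t).toRingHom (ModuleCat.of R I) (ModuleCat.of R I)
    (idealAct hI t⁻¹).toAddMonoidHom (idealAct_inv_smul hI t)

/-- The action of the torus on `Extⁿ(I, I)` over `R`: for `n = 0` it sends an endomorphism `h` of
`I` to `t ∘ h ∘ t⁻¹`, and in general it is transport of structure along the automorphism `t⁻¹` of
`R` and the corresponding identification of `I` with its twist. -/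
def extAct (n : ℕ) (t : ℝˣ) :
    Abelian.Ext.{0} (ModuleCat.of R I) (ModuleCat.of R I) n →ₗ[ℝ]
      Abelian.Ext.{0} (ModuleCat.of R I) (ModuleCat.of R I) n where
  toFun e := (Abelian.Ext.mk₀ (toTwist hI t⁻¹)).comp
    ((e.mapExactFunctor (twist w t⁻¹)).comp (Abelian.Ext.mk₀ (fromTwist hI t⁻¹)) (add_zero n))
    (zero_add n)
  map_add' e e' := by simp
  map_smul' r e := by
    have : (twist w t⁻¹).Linear ℝ := inferInstance
    simp

end Torus

/-! ### Monomial ideals -/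

/-- `I` is a monomial ideal. -/
def IsMonomial (I : Ideal R) : Prop :=
  ∃ S : Set (Fin 3 →₀ ℕ), I = Ideal.span ((fun m => monomial m (1 : ℝ)) '' S)

/-- The set `π_I` of exponents of the monomials outside `I`. -/
def stdMonomials (I : Ideal R) : Set (Fin 3 →₀ ℕ) := {m | monomial m (1 : ℝ) ∉ I}

end NSTrace

end

open CategoryTheory AlgebraicGeometry MvPolynomial
open scoped LaurentPolynomial MatrixGroups HomogeneousIdeal

noncomputable section

namespace NSTrace

/-! ### Transport of `Ext` along an exact endofunctor -/

section ExtTransport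

open Abelian

variable {C : Type*} [Category C] [Abelian C] [HasExt.{0} C]
  (G : C ⥤ C) [G.Additive] [Limits.PreservesFiniteLimits G] [Limits.PreservesFiniteColimits G]

/-! Write M = R/I, and let Q̄ be Q evaluated at t⁻¹. Since R is projective, the connecting map of 0
→ I → R → M → 0 identifies Ext¹(I, I) and Ext²(I, I) with Ext²(M, I) and Ext³(M, I)
(`trace_extAct`). The long exact sequence of Ext(M, -) for the same short exact sequence then
expresses the difference of their traces through Ext(M, R), Ext(M, M) and Ext¹(M, I)
(`trace_extAct_sub`). Three computations finish it: Ext¹(M, I) ≅ Hom(M, M) ≅ M contributes Q;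
Extⁿ(M, R) vanishes for n < 3 and Ext³(M, R) is the dual of M twisted by (s₁s₂s₃)⁻¹, contributing
Q̄/(s₁s₂s₃) (`trace_ext_ring_three`); and the alternating sum of the traces on Ext(M, M) is Q Q̄ ∏(1
- sᵢ⁻¹) (`eulerTrace_eq`).

The last two rest on an equivariant Koszul resolution, used one step at a time. On R ⊗_ℝ M the
operators κᵢ = xᵢ ⊗ 1 - 1 ⊗ xᵢ commute, form a regular sequence and have common cokernel M
(`koszul_one_regular`, `koszul_two_regular`, `exact_tower₂Aug`). As κᵢ has weight sᵢ, each quotient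
by a κᵢ multiplies the Euler trace by 1 - sᵢ⁻¹ (`eulerTrace_of_shortExact`), starting from Hom_R(R ⊗
M, N) = Hom_ℝ(M, N). For N = R this Hom space is R ⊗ M*, on which κᵢ again acts as κᵢ
(`freeDual_koszul`), so the same regularity computes Ext(M, R).

Equivariance of all connecting maps follows from one fact: the torus fixes the Ext¹ class of an
equivariant short exact sequence (`ext_sesClass`). Weight decompositions are inherited from the
monomials of R through equivariant surjections and injections; identities of Laurent polynomials are
then checked as identities of operator traces at each nonzero real t (`ext_of_evalLaurent`,
`evalLaurent_tr`).

The geometric input is that the chart ideal is torus-stable (`isTorusStable_chartIdeal`) and of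
finite codimension (`finiteDimensional_quot_chartIdeal`). -/

/-- The endomorphism of `Extⁿ(X, Y)` induced by an exact endofunctor `G` and morphisms
`X ⟶ G X` and `G Y ⟶ Y`. -/
def extTransport {X Y : C} {n : ℕ} (φ : X ⟶ G.obj X) (ψ : G.obj Y ⟶ Y) (e : Ext.{0} X Y n) :
    Ext.{0} X Y n :=
  (Ext.mk₀ φ).comp ((e.mapExactFunctor G).comp (Ext.mk₀ ψ) (add_zero n)) (zero_add n)

lemma extTransport_mk₀ {X Y : C} (φ : X ⟶ G.obj X) (ψ : G.obj Y ⟶ Y) (h : X ⟶ Y) :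
    extTransport G φ ψ (Ext.mk₀ h) = Ext.mk₀ (φ ≫ G.map h ≫ ψ) := by
  simp [extTransport, Ext.mapExactFunctor_mk₀]

/-- The maps `ψY` and `φY` inserted at the middle object cancel, which is why transport respects the
Yoneda product. -/
lemma extTransport_comp {X Y Z : C} {a b c : ℕ} (h : a + b = c)
    (φX : X ⟶ G.obj X) (φY : Y ⟶ G.obj Y) (ψY : G.obj Y ⟶ Y) (ψZ : G.obj Z ⟶ Z)
    (hY : ψY ≫ φY = 𝟙 _) (e : Ext.{0} X Y a) (e' : Ext.{0} Y Z b) :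
    extTransport G φX ψZ (e.comp e' h) =
      (extTransport G φX ψY e).comp (extTransport G φY ψZ e') h := by
  unfold extTransport
  rw [Ext.mapExactFunctor_comp _ _ _ h]
  generalize e.mapExactFunctor G = A
  generalize e'.mapExactFunctor G = B
  have h1 : (A.comp (Ext.mk₀ ψY) (add_zero a)).comp
      ((Ext.mk₀ φY).comp (B.comp (Ext.mk₀ ψZ) (add_zero b)) (zero_add b)) h =
      A.comp (B.comp (Ext.mk₀ ψZ) (add_zero b)) h := by
    rw [Ext.comp_assoc_of_second_deg_zero, Ext.mk₀_comp_mk₀_assoc, hY, Ext.mk₀_id_comp]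
  rw [Ext.comp_assoc (Ext.mk₀ φX) (A.comp (Ext.mk₀ ψY) (add_zero a)) _ (zero_add a) h (by omega),
    h1, Ext.comp_assoc_of_third_deg_zero]

/-- The maps `φᵢ` form a morphism from `S` to its image under `G`, and `G` carries the class of `S`
to the class of that image. Naturality of the extension class gives the equality once `ψ₁` undoes
`φ₁`. -/
lemma extTransport_extClass {S : ShortComplex C} (hS : S.ShortExact)
    (φ₁ : S.X₁ ⟶ G.obj S.X₁) (φ₂ : S.X₂ ⟶ G.obj S.X₂) (φ₃ : S.X₃ ⟶ G.obj S.X₃)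
    (ψ₁ : G.obj S.X₁ ⟶ S.X₁) (h₁ : φ₁ ≫ ψ₁ = 𝟙 _)
    (hf : φ₁ ≫ G.map S.f = S.f ≫ φ₂) (hg : φ₂ ≫ G.map S.g = S.g ≫ φ₃) :
    extTransport G φ₃ ψ₁ hS.extClass = hS.extClass := by
  have h : hS.extClass.comp (Ext.mk₀ φ₁) (add_zero 1) = (Ext.mk₀ φ₃).comp
      (Y := G.obj S.X₃) (Z := G.obj S.X₁) (hS.map_of_exact G).extClass (zero_add 1) :=
    ShortComplex.ShortExact.extClass_naturality hS (hS.map_of_exact G)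
      { τ₁ := φ₁, τ₂ := φ₂, τ₃ := φ₃, comm₁₂ := hf, comm₂₃ := hg }
  have h' : hS.extClass.mapExactFunctor G = (hS.map_of_exact G).extClass :=
    Ext.mapExactFunctor_extClass G hS
  unfold extTransport
  rw [← Ext.comp_assoc (Ext.mk₀ φ₃) _ (Ext.mk₀ ψ₁) (zero_add 1) (add_zero 1) (by omega), h']
  refine (congrArg (fun z => Ext.comp z (Ext.mk₀ ψ₁) (add_zero 1)) h.symm).trans ?_
  rw [Ext.comp_assoc_of_third_deg_zero]
  simp [h₁]

end ExtTransport

/-! ### Torus-equivariant modules and the torus action on `Ext` -/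

/-- An action of the torus on an `R`-module, compatible with its action on `R`. -/
structure TorusAction (w : Fin 3 → ℤ) (L : Type) [AddCommGroup L] [Module R L] where
  /-- The action of `t`. -/
  act : ℝˣ → L →+ L
  act_smul : ∀ t (r : R) l, act t (r • l) = torusAct w t r • act t l
  act_act_inv : ∀ t l, act t (act t⁻¹ l) = l

namespace TorusAction

open Abelian

variable {w : Fin 3 → ℤ} {L L₁ L₂ L₃ N : Type}
  [AddCommGroup L] [Module R L] [AddCommGroup L₁] [Module R L₁] [AddCommGroup L₂] [Module R L₂]
  [AddCommGroup L₃] [Module R L₃] [AddCommGroup N] [Module R N]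

lemma act_inv_act (A : TorusAction w L) (t : ℝˣ) (l : L) : A.act t⁻¹ (A.act t l) = l := by
  simpa using A.act_act_inv t⁻¹ l

lemma act_inv_smul (A : TorusAction w L) (t : ℝˣ) (r : R) (l : L) :
    A.act t⁻¹ (torusAct w t r • l) = r • A.act t⁻¹ l := by
  have h := torusAct_mul_inv w t⁻¹ r
  rw [inv_inv] at h
  rw [A.act_smul, h]

/-- The action of `t` as a morphism to the twist by `t`. -/
def toTwist (A : TorusAction w L) (t : ℝˣ) :
    ModuleCat.of R L ⟶ (twist w t).obj (ModuleCat.of R L) :=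
  ModuleCat.semilinearMapAddEquiv (torusAct w t).toRingHom (ModuleCat.of R L) (ModuleCat.of R L)
    { toFun := A.act t
      map_add' := map_add _
      map_smul' := A.act_smul t }

/-- The action of `t⁻¹` as a morphism from the twist by `t`. -/
def fromTwist (A : TorusAction w L) (t : ℝˣ) :
    (twist w t).obj (ModuleCat.of R L) ⟶ ModuleCat.of R L :=
  ofRestrictScalars (torusAct w t).toRingHom (ModuleCat.of R L) (ModuleCat.of R L)
    (A.act t⁻¹) (A.act_inv_smul t)

lemma toTwist_fromTwist (A : TorusAction w L) (t : ℝˣ) : A.toTwist t ≫ A.fromTwist t = 𝟙 _ := by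
  ext l
  exact A.act_inv_act t l

lemma fromTwist_toTwist (A : TorusAction w L) (t : ℝˣ) : A.fromTwist t ≫ A.toTwist t = 𝟙 _ := by
  ext l
  exact A.act_act_inv t l

/-- The action of the torus on `Extⁿ(L, N)`. -/
def ext (A : TorusAction w L) (B : TorusAction w N) (n : ℕ) (t : ℝˣ) :
    Ext.{0} (ModuleCat.of R L) (ModuleCat.of R N) n →ₗ[ℝ]
      Ext.{0} (ModuleCat.of R L) (ModuleCat.of R N) n where
  toFun e := extTransport (twist w t⁻¹) (A.toTwist t⁻¹) (B.fromTwist t⁻¹) e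
  map_add' e e' := by simp [extTransport]
  map_smul' r e := by
    have : (twist w t⁻¹).Linear ℝ := inferInstance
    simp [extTransport]

lemma ext_apply (A : TorusAction w L) (B : TorusAction w N) (n : ℕ) (t : ℝˣ)
    (e : Ext.{0} (ModuleCat.of R L) (ModuleCat.of R N) n) :
    A.ext B n t e = extTransport (twist w t⁻¹) (A.toTwist t⁻¹) (B.fromTwist t⁻¹) e := rfl

lemma ext_comp (A₁ : TorusAction w L₁) (A₂ : TorusAction w L₂) (A₃ : TorusAction w L₃)
    {a b c : ℕ} (h : a + b = c) (t : ℝˣ)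
    (e : Ext.{0} (ModuleCat.of R L₁) (ModuleCat.of R L₂) a)
    (e' : Ext.{0} (ModuleCat.of R L₂) (ModuleCat.of R L₃) b) :
    A₁.ext A₃ c t (e.comp e' h) = (A₁.ext A₂ a t e).comp (A₂.ext A₃ b t e') h :=
  extTransport_comp _ h _ _ _ _ (A₂.fromTwist_toTwist _) e e'

/-- The action of `t` on `Hom(L, N)`. -/
def homAct (A : TorusAction w L) (B : TorusAction w N) (t : ℝˣ) (h : L →ₗ[R] N) : L →ₗ[R] N where
  toFun l := B.act t (h (A.act t⁻¹ l))
  map_add' := by simp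
  map_smul' r l := by
    have h1 := torusAct_mul_inv w t r
    rw [A.act_smul, map_smul, B.act_smul, h1]
    rfl

lemma homAct_apply (A : TorusAction w L) (B : TorusAction w N) (t : ℝˣ) (h : L →ₗ[R] N) (l : L) :
    A.homAct B t h l = B.act t (h (A.act t⁻¹ l)) := rfl

/-- Restriction of scalars does not change the underlying map, so in degree 0 transport of structure
is plain conjugation. -/
lemma ext_mk₀ (A : TorusAction w L) (B : TorusAction w N) (t : ℝˣ) (h : L →ₗ[R] N) :
    A.ext B 0 t (Ext.mk₀ (ModuleCat.ofHom h)) = Ext.mk₀ (ModuleCat.ofHom (A.homAct B t h)) := by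
  rw [ext_apply, extTransport_mk₀]
  congr 1

/-- The map `h` commutes with the actions of the torus. -/
def IsEquivariant (A : TorusAction w L) (B : TorusAction w N) (h : L →ₗ[R] N) : Prop :=
  ∀ t l, h (A.act t l) = B.act t (h l)

lemma IsEquivariant.ext_mk₀ {A : TorusAction w L} {B : TorusAction w N} {h : L →ₗ[R] N}
    (hh : A.IsEquivariant B h) (t : ℝˣ) :
    A.ext B 0 t (Ext.mk₀ (ModuleCat.ofHom h)) = Ext.mk₀ (ModuleCat.ofHom h) := by
  rw [TorusAction.ext_mk₀]
  congr 2
  ext l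
  rw [homAct_apply, ← hh, A.act_act_inv]

/-- The short complex of `R`-modules given by an exact pair of maps. -/
def ses (f : L₁ →ₗ[R] L₂) (g : L₂ →ₗ[R] L₃) (h : Function.Exact f g) :
    ShortComplex (ModuleCat.{0} R) :=
  ShortComplex.mk (ModuleCat.ofHom f) (ModuleCat.ofHom g) (by
    ext l
    exact h.apply_apply_eq_zero l)

lemma ses_shortExact {f : L₁ →ₗ[R] L₂} {g : L₂ →ₗ[R] L₃} (h : Function.Exact f g)
    (hf : Function.Injective f) (hg : Function.Surjective g) : (ses f g h).ShortExact where
  exact := by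
    rw [ShortComplex.ShortExact.moduleCat_exact_iff_function_exact]
    exact h
  mono_f := (ModuleCat.mono_iff_injective _).2 hf
  epi_g := (ModuleCat.epi_iff_surjective _).2 hg

/-- The class in `Ext¹` of a short exact sequence of `R`-modules. -/
def sesClass {f : L₁ →ₗ[R] L₂} {g : L₂ →ₗ[R] L₃} (h : Function.Exact f g)
    (hf : Function.Injective f) (hg : Function.Surjective g) :
    Ext.{0} (ModuleCat.of R L₃) (ModuleCat.of R L₁) 1 :=
  (ses_shortExact h hf hg).extClass

/-- This invariance makes the connecting maps equivariant, since they are Yoneda products with the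
class. -/
lemma ext_sesClass {A₁ : TorusAction w L₁} {A₂ : TorusAction w L₂} {A₃ : TorusAction w L₃}
    {f : L₁ →ₗ[R] L₂} {g : L₂ →ₗ[R] L₃} (h : Function.Exact f g)
    (hf : Function.Injective f) (hg : Function.Surjective g)
    (ef : A₁.IsEquivariant A₂ f) (eg : A₂.IsEquivariant A₃ g) (t : ℝˣ) :
    A₃.ext A₁ 1 t (sesClass h hf hg) = sesClass h hf hg := by
  refine extTransport_extClass (twist w t⁻¹) (ses_shortExact h hf hg) (A₁.toTwist t⁻¹)
    (A₂.toTwist t⁻¹) (A₃.toTwist t⁻¹) (A₁.fromTwist t⁻¹) (A₁.toTwist_fromTwist _) ?_ ?_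
  · ext l
    exact ef t⁻¹ l
  · ext l
    exact eg t⁻¹ l

/-- The action multiplied by a character. -/
@[simps]
def scale (A : TorusAction w L) (c : ℝˣ →* ℝˣ) : TorusAction w L where
  act t := (DistribSMul.toAddMonoidHom L (C (c t : ℝ) : R)).comp (A.act t)
  act_smul t r l := by
    simp only [AddMonoidHom.comp_apply, DistribSMul.toAddMonoidHom_apply, A.act_smul, smul_smul,
      mul_comm]
  act_act_inv t l := by
    simp only [AddMonoidHom.comp_apply, DistribSMul.toAddMonoidHom_apply, A.act_smul, smul_smul,
      A.act_act_inv]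
    have : (torusAct w t) (C (c t⁻¹ : ℝ)) = C (c t⁻¹ : ℝ) := (torusAct w t).commutes _
    rw [this, ← C_mul]
    simp

/-- Ext is contravariant in its first argument, so a character on the source enters through its
inverse. -/
lemma scale_ext (A : TorusAction w L) (B : TorusAction w N) (c : ℝˣ →* ℝˣ) (n : ℕ) (t : ℝˣ) :
    (A.scale c).ext B n t = ((c t)⁻¹ : ℝˣ).1 • A.ext B n t := by
  ext e
  have h : (A.scale c).toTwist t⁻¹ = ((c t)⁻¹ : ℝˣ).1 • A.toTwist t⁻¹ := by
    ext l
    change (C (c t⁻¹ : ℝ) : R) • A.act t⁻¹ l =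
      (torusAct w t⁻¹) (algebraMap ℝ R (((c t)⁻¹ : ℝˣ) : ℝ)) • A.act t⁻¹ l
    rw [AlgHom.commutes, map_inv]
    rfl
  simp [ext_apply, extTransport, h, Ext.mk₀_smul]

end TorusAction

/-- The action of the torus on a stable ideal. -/
def idealAction {w : Fin 3 → ℤ} {I : Ideal R} (hI : IsTorusStable w I) : TorusAction w I where
  act t := (idealAct hI t).toAddMonoidHom
  act_smul t r l := (idealAct hI t).map_smulₛₗ r l
  act_act_inv t l := Subtype.ext (torusAct_mul_inv w t l.1)

/-! ### Traces of endomorphisms of exact sequences -/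

section Trace

variable {k V₀ V V' V'' : Type*} [Field k] [AddCommGroup V₀] [Module k V₀]
  [AddCommGroup V] [Module k V] [AddCommGroup V'] [Module k V']
  [AddCommGroup V''] [Module k V'']

lemma mapsTo_range_of_comm {f : V →ₗ[k] V'} {T : V →ₗ[k] V} {T' : V' →ₗ[k] V'}
    (h : ∀ v, f (T v) = T' (f v)) : ∀ x ∈ LinearMap.range f, T' x ∈ LinearMap.range f := by
  rintro _ ⟨v, rfl⟩
  exact ⟨T v, h v⟩

/-- The trace of an endomorphism `T'` on the range of a map `f` (zero if the range is not
stable). -/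
def traceRange (f : V →ₗ[k] V') (T' : V' →ₗ[k] V') : k :=
  open scoped Classical in
  if h : ∀ x ∈ LinearMap.range f, T' x ∈ LinearMap.range f then
    LinearMap.trace k _ (T'.restrict h) else 0

lemma traceRange_eq {f : V →ₗ[k] V'} {T' : V' →ₗ[k] V'}
    (h : ∀ x ∈ LinearMap.range f, T' x ∈ LinearMap.range f) :
    traceRange f T' = LinearMap.trace k _ (T'.restrict h) := dif_pos h

lemma traceRange_eq_zero {f : V →ₗ[k] V'} {T' : V' →ₗ[k] V'} (hf : f = 0) :
    traceRange f T' = 0 := by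
  subst hf
  have h : ∀ x ∈ LinearMap.range (0 : V →ₗ[k] V'), T' x ∈ LinearMap.range (0 : V →ₗ[k] V') := by
    simp
  rw [traceRange_eq h]
  have : Subsingleton (LinearMap.range (0 : V →ₗ[k] V')) := by
    rw [LinearMap.range_zero]; infer_instance
  rw [Subsingleton.elim (T'.restrict h) 0, map_zero]

/-- A linear section `s` of `g` onto its range writes `T` as a sum of two composites, through the
kernel and through the range; cyclicity of the trace turns them into the two restricted operators.
The section need not commute with `T`. -/
lemma trace_eq_trace_ker_add_trace_range [FiniteDimensional k V] {g : V →ₗ[k] V'}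
    {T : V →ₗ[k] V} {T' : V' →ₗ[k] V'} (hg : ∀ v, g (T v) = T' (g v))
    (h : ∀ x ∈ LinearMap.ker g, T x ∈ LinearMap.ker g) :
    LinearMap.trace k V T = LinearMap.trace k _ (T.restrict h) + traceRange g T' := by
  obtain ⟨s, hs⟩ := g.rangeRestrict.exists_rightInverse_of_surjective g.range_rangeRestrict
  have hs' : ∀ x, g (s x) = x := fun x => congrArg Subtype.val (LinearMap.congr_fun hs x)
  let P : V →ₗ[k] LinearMap.ker g := LinearMap.codRestrict _ (LinearMap.id - s ∘ₗ g.rangeRestrict)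
    (fun v => by simp [hs'])
  have e : T = (T ∘ₗ (LinearMap.ker g).subtype) ∘ₗ P + (T ∘ₗ s) ∘ₗ g.rangeRestrict := by
    ext v; simp [P]
  rw [traceRange_eq (mapsTo_range_of_comm hg)]
  conv_lhs => rw [e]
  rw [map_add, LinearMap.trace_comp_comm', LinearMap.trace_comp_comm' g.rangeRestrict (T ∘ₗ s)]
  congr 2
  · ext x
    have : g (T x) = 0 := by rw [hg, x.2, map_zero]
    have h0 : g.rangeRestrict (T x) = 0 := Subtype.ext this
    simp [P, h0]
  · ext x
    simp [hg, hs']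

lemma trace_restrict_congr {p q : Submodule k V} (e : p = q) {T : V →ₗ[k] V}
    (hp : ∀ x ∈ p, T x ∈ p) (hq : ∀ x ∈ q, T x ∈ q) :
    LinearMap.trace k _ (T.restrict hp) = LinearMap.trace k _ (T.restrict hq) := by
  subst e
  rfl

/-- Each trace in a long exact sequence becomes a sum of two terms attached to the adjacent maps;
these are the terms that telescope. -/
lemma trace_eq_of_exact [FiniteDimensional k V] {f : V₀ →ₗ[k] V} {g : V →ₗ[k] V'}
    {T₀ : V₀ →ₗ[k] V₀} {T : V →ₗ[k] V} {T' : V' →ₗ[k] V'}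
    (hf : ∀ v, f (T₀ v) = T (f v)) (hg : ∀ v, g (T v) = T' (g v)) (hfg : Function.Exact f g) :
    LinearMap.trace k V T = traceRange f T + traceRange g T' := by
  have e : LinearMap.ker g = LinearMap.range f := LinearMap.exact_iff.1 hfg
  have h := mapsTo_range_of_comm hf
  rw [traceRange_eq h]
  have h' := h
  rw [← e] at h'
  rw [trace_eq_trace_ker_add_trace_range hg h']
  congr 1
  exact trace_restrict_congr e h' h

/-- Both targets are the quotient of `V` by one kernel. `V` may be infinite-dimensional, as it is
when Ext³(M, R) and M* are compared as quotients of R ⊗ M*. -/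
lemma trace_eq_of_surjective_of_ker_eq {f : V →ₗ[k] V'} {g : V →ₗ[k] V''}
    (hf : Function.Surjective f) (hg : Function.Surjective g)
    (hk : LinearMap.ker f = LinearMap.ker g) {T : V →ₗ[k] V} {T' : V' →ₗ[k] V'}
    {T'' : V'' →ₗ[k] V''} (hT' : ∀ v, f (T v) = T' (f v)) (hT'' : ∀ v, g (T v) = T'' (g v)) :
    LinearMap.trace k V' T' = LinearMap.trace k V'' T'' := by
  let e : V' ≃ₗ[k] V'' := (f.quotKerEquivOfSurjective hf).symm ≪≫ₗ
    Submodule.quotEquivOfEq _ _ hk ≪≫ₗ g.quotKerEquivOfSurjective hg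
  have he : ∀ v, e (f v) = g v := by
    intro v
    have : (f.quotKerEquivOfSurjective hf).symm (f v) = Submodule.Quotient.mk v := by
      rw [LinearEquiv.symm_apply_eq]; rfl
    simp only [e, LinearEquiv.trans_apply, this]
    rfl
  rw [← LinearMap.trace_conj' T' e]
  congr 1
  ext x
  obtain ⟨v, rfl⟩ := hg x
  rw [LinearEquiv.conj_apply_apply, ← he, LinearEquiv.symm_apply_apply, ← hT', he, hT'', he]

lemma trace_eq_of_equiv (e : V ≃ₗ[k] V') {T : V →ₗ[k] V} {T' : V' →ₗ[k] V'}
    (h : ∀ v, e (T v) = T' (e v)) : LinearMap.trace k V T = LinearMap.trace k V' T' :=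
  trace_eq_of_surjective_of_ker_eq (f := LinearMap.id) (g := e.toLinearMap) (T := T)
    Function.surjective_id e.surjective (by simp) (fun _ => rfl) h

/-- The alternating sum of traces in a long exact sequence
`0 → A 0 → B 0 → C 0 → A 1 → B 1 → ⋯`, up to the last connecting map. -/
lemma sum_trace_of_longExact {A B C : ℕ → Type*}
    [∀ n, AddCommGroup (A n)] [∀ n, Module k (A n)] [∀ n, FiniteDimensional k (A n)]
    [∀ n, AddCommGroup (B n)] [∀ n, Module k (B n)] [∀ n, FiniteDimensional k (B n)]
    [∀ n, AddCommGroup (C n)] [∀ n, Module k (C n)] [∀ n, FiniteDimensional k (C n)]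
    (f : ∀ n, A n →ₗ[k] B n) (g : ∀ n, B n →ₗ[k] C n) (d : ∀ n, C n →ₗ[k] A (n + 1))
    (S : ∀ n, A n →ₗ[k] A n) (T : ∀ n, B n →ₗ[k] B n) (U : ∀ n, C n →ₗ[k] C n)
    (hf : ∀ n x, f n (S n x) = T n (f n x)) (hg : ∀ n x, g n (T n x) = U n (g n x))
    (hd : ∀ n x, d n (U n x) = S (n + 1) (d n x))
    (h0 : Function.Injective (f 0)) (hfg : ∀ n, Function.Exact (f n) (g n))
    (hgd : ∀ n, Function.Exact (g n) (d n)) (hdf : ∀ n, Function.Exact (d n) (f (n + 1)))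
    (N : ℕ) (hN : d N = 0) :
    ∑ n ∈ Finset.range (N + 1), (-1) ^ n * (LinearMap.trace k _ (S n) -
      LinearMap.trace k _ (T n) + LinearMap.trace k _ (U n)) = 0 := by
  -- The partial sums telescope: only the trace on the range of the last connecting map survives.
  have key : ∀ n, ∑ m ∈ Finset.range (n + 1), (-1) ^ m * (LinearMap.trace k _ (S m) -
      LinearMap.trace k _ (T m) + LinearMap.trace k _ (U m)) =
      (-1) ^ n * traceRange (d n) (S (n + 1)) := by
    intro n
    induction n with
    | zero =>
      have e0 : Function.Exact (0 : A 0 →ₗ[k] A 0) (f 0) := by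
        rw [LinearMap.exact_iff, LinearMap.ker_eq_bot.2 h0, LinearMap.range_zero]
      have h1 := trace_eq_of_exact (T₀ := S 0) (by simp) (hf 0) e0
      have h2 := trace_eq_of_exact (hf 0) (hg 0) (hfg 0)
      have h3 := trace_eq_of_exact (hg 0) (hd 0) (hgd 0)
      rw [traceRange_eq_zero rfl] at h1
      simp only [zero_add, Finset.range_one, Finset.sum_singleton, pow_zero, one_mul, h1, h2, h3]
      ring
    | succ n ih =>
      rw [Finset.sum_range_succ, ih]
      have h1 := trace_eq_of_exact (hd n) (hf (n + 1)) (hdf n)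
      have h2 := trace_eq_of_exact (hf (n + 1)) (hg (n + 1)) (hfg (n + 1))
      have h3 := trace_eq_of_exact (hg (n + 1)) (hd (n + 1)) (hgd (n + 1))
      rw [h1, h2, h3]
      ring
  rw [key, traceRange_eq_zero hN, mul_zero]

lemma finiteDimensional_of_exact [FiniteDimensional k V] [FiniteDimensional k V'']
    {f : V →ₗ[k] V'} {g : V' →ₗ[k] V''} (h : Function.Exact f g) : FiniteDimensional k V' := by
  have := Submodule.fg_of_fg_map_of_fg_inf_ker (R := k) g (s := ⊤)
    (IsNoetherian.noetherian _) (by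
      rw [top_inf_eq, LinearMap.exact_iff.1 h]
      exact Module.Finite.iff_fg.1 inferInstance)
  exact ⟨this⟩

end Trace

/-! ### Weight space decompositions -/

section Weights

variable {V V' A B : Type} [AddCommGroup V] [Module ℝ V] [AddCommGroup V'] [Module ℝ V']
  [AddCommGroup A] [Module ℝ A] [AddCommGroup B] [Module ℝ B]

/-- `V` is spanned by its weight spaces. -/
def IsSpannedByWeights (ρ : ℝˣ → V →ₗ[ℝ] V) : Prop := ⨆ m, weightSpace ρ m = ⊤

/-- The unit `2`. -/
def twoUnit : ℝˣ := Units.mk0 2 two_ne_zero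

lemma two_zpow_injective : Function.Injective fun m : ℤ => ((twoUnit : ℝˣ) : ℝ) ^ m :=
  zpow_right_injective₀ (by norm_num [twoUnit]) (by norm_num [twoUnit])

lemma weightSpace_le_eigenspace (ρ : ℝˣ → V →ₗ[ℝ] V) (m : ℤ) :
    weightSpace ρ m ≤ Module.End.eigenspace (ρ twoUnit) ((twoUnit : ℝ) ^ m) := by
  intro v hv
  rw [Module.End.mem_eigenspace_iff]
  exact (mem_weightSpace ρ m v).1 hv twoUnit

/-- The single element t = 2 separates the weights: the powers 2^m are distinct, and eigenspaces for
distinct eigenvalues are independent. -/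
lemma iSupIndep_weightSpace (ρ : ℝˣ → V →ₗ[ℝ] V) : iSupIndep (weightSpace ρ) :=
  ((Module.End.eigenspaces_iSupIndep (ρ twoUnit)).comp two_zpow_injective).mono
    (weightSpace_le_eigenspace ρ)

lemma IsSpannedByWeights.isFiniteTorusRep [FiniteDimensional ℝ V] {ρ : ℝˣ → V →ₗ[ℝ] V}
    (h : IsSpannedByWeights ρ) : IsFiniteTorusRep ρ :=
  ⟨inferInstance, DirectSum.isInternal_submodule_of_iSupIndep_of_iSup_eq_top
    (iSupIndep_weightSpace ρ) h⟩

/-- A surjection that is equivariant up to a character preserves being spanned by weights. -/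
lemma IsSpannedByWeights.of_surjective {ρ : ℝˣ → V →ₗ[ℝ] V} {ρ' : ℝˣ → V' →ₗ[ℝ] V'}
    (h : IsSpannedByWeights ρ) {f : V →ₗ[ℝ] V'} (hf : Function.Surjective f) (d : ℤ)
    (hρ : ∀ t v, f (ρ t v) = ((t : ℝ) ^ d) • ρ' t (f v)) : IsSpannedByWeights ρ' := by
  refine top_le_iff.1 ?_
  rw [← LinearMap.range_eq_top.2 hf, LinearMap.range_eq_map, ← h, Submodule.map_iSup]
  refine iSup_le fun m => ?_
  -- The twist by `d` moves the image of the weight `m` space into weight `m - d`.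
  refine le_trans ?_ (le_iSup _ (m - d))
  rintro _ ⟨v, hv, rfl⟩
  rw [mem_weightSpace]
  intro t
  have h1 := hρ t v
  rw [(mem_weightSpace ρ m v).1 hv t, map_smul] at h1
  rw [zpow_sub₀ t.ne_zero, div_eq_inv_mul, mul_smul, h1, smul_smul,
    inv_mul_cancel₀ (zpow_ne_zero _ t.ne_zero), one_smul]

/-- A stable subspace of a space spanned by weights is spanned by weights. -/
lemma IsSpannedByWeights.of_injective {ρ : ℝˣ → V →ₗ[ℝ] V} {ρ' : ℝˣ → V' →ₗ[ℝ] V'}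
    (h : IsSpannedByWeights ρ') {f : V →ₗ[ℝ] V'} (hf : Function.Injective f)
    (hρ : ∀ t v, f (ρ t v) = ρ' t (f v)) : IsSpannedByWeights ρ := by
  classical
  refine top_le_iff.1 fun v _ => ?_
  obtain ⟨x, hx, hsum⟩ := (Submodule.mem_iSup_iff_exists_finsupp (weightSpace ρ') (f v)).1
    (by rw [show _ = _ from h]; trivial)
  have hp : ∀ (p : Polynomial ℝ) (u : V), f (Polynomial.aeval (ρ twoUnit) p u) =
      Polynomial.aeval (ρ' twoUnit) p (f u) := by
    intro p u
    induction p using Polynomial.induction_on generalizing u with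
    | C a => simp
    | add p q hp hq => simp [hp, hq]
    | monomial n a ih =>
      rw [pow_succ, ← mul_assoc, map_mul, map_mul _ (_ * _), Module.End.mul_apply, ih,
        Module.End.mul_apply, Polynomial.aeval_X, Polynomial.aeval_X, hρ]
  -- The Lagrange polynomial that is 1 at 2^m and 0 at the other occurring 2^n, applied to the
  -- operator of t = 2, extracts the component of weight `m`. Being a polynomial in that operator,
  -- it can be applied already in `V`.
  let p : ℤ → Polynomial ℝ := fun m =>
    Lagrange.basis x.support (fun m : ℤ => ((twoUnit : ℝˣ) : ℝ) ^ m) m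
  have hpx : ∀ m ∈ x.support, f (Polynomial.aeval (ρ twoUnit) (p m) v) = x m := by
    intro m hm
    rw [hp, ← hsum, Finsupp.sum, map_sum, Finset.sum_eq_single m]
    · have h1 := Module.End.aeval_apply_of_mem_apply_eq_smul (p := p m)
        ((mem_weightSpace ρ' m _).1 (hx m) twoUnit)
      rw [h1, Lagrange.eval_basis_self two_zpow_injective.injOn hm, one_smul]
    · intro n hn hnm
      have h1 := Module.End.aeval_apply_of_mem_apply_eq_smul (p := p m)
        ((mem_weightSpace ρ' n _).1 (hx n) twoUnit)
      rw [h1, Lagrange.eval_basis_of_ne hnm.symm hn, zero_smul]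
    · exact fun h => absurd hm h
  have hv : v = ∑ m ∈ x.support, Polynomial.aeval (ρ twoUnit) (p m) v := by
    apply hf
    rw [map_sum, Finset.sum_congr rfl hpx, ← hsum, Finsupp.sum]
  rw [hv]
  refine Submodule.sum_mem _ fun m hm => Submodule.mem_iSup_of_mem m ?_
  rw [mem_weightSpace]
  intro t
  apply hf
  rw [hρ, hpx m hm, map_smul, hpx m hm]
  exact (mem_weightSpace ρ' m (x m)).1 (hx m) t

lemma IsSpannedByWeights.exists_basis {ρ : ℝˣ → V →ₗ[ℝ] V} (h : IsSpannedByWeights ρ) :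
    ∃ (ι : Type) (b : Module.Basis ι ℝ V) (d : ι → ℤ), ∀ i, b i ∈ weightSpace ρ (d i) := by
  have hs : ⊤ ≤ Submodule.span ℝ (⋃ m, (weightSpace ρ m : Set V)) := by
    rw [← h, Submodule.iSup_eq_span]
  have hb : ∀ i, ∃ m, Module.Basis.ofSpan hs i ∈ weightSpace ρ m := fun i => by
    simpa using Module.Basis.ofSpan_subset hs ⟨i, rfl⟩
  choose d hd using hb
  exact ⟨_, Module.Basis.ofSpan hs, d, hd⟩

/-- Linear maps from a finite-dimensional torus representation to a representation spanned by
weights are spanned by weights. -/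
lemma IsSpannedByWeights.linearMap [FiniteDimensional ℝ A] {ρA : ℝˣ → A →ₗ[ℝ] A}
    {ρB : ℝˣ → B →ₗ[ℝ] B} (hA : IsSpannedByWeights ρA) (hB : IsSpannedByWeights ρB)
    (ρ : ℝˣ → (A →ₗ[ℝ] B) →ₗ[ℝ] (A →ₗ[ℝ] B))
    (hρ : ∀ t h a, ρ t h a = ρB t (h (ρA t⁻¹ a))) : IsSpannedByWeights ρ := by
  obtain ⟨ι, b, d, hb⟩ := hA.exists_basis
  have : Fintype ι := FiniteDimensional.fintypeBasisIndex b
  have hcoord : ∀ i t a, b.coord i (ρA t⁻¹ a) = ((t : ℝ) ^ (-d i)) * b.coord i a := by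
    classical
    intro i t
    have : b.coord i ∘ₗ ρA t⁻¹ = ((t : ℝ) ^ (-d i)) • b.coord i := by
      refine b.ext fun j => ?_
      rw [LinearMap.comp_apply, (mem_weightSpace ρA _ _).1 (hb j) t⁻¹]
      by_cases hij : j = i
      · subst hij; simp
      · simp [hij]
    exact fun a => LinearMap.congr_fun this a
  -- A rank-one map built from the dual basis vector of `b i` and a vector of weight `m` has weight
  -- `-d i + m`; such maps span because `A` is finite-dimensional.
  have key : ∀ i, ∀ v : B, LinearMap.smulRight (b.coord i) v ∈ ⨆ m, weightSpace ρ m := by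
    intro i v
    have hv : v ∈ ⨆ m, weightSpace ρB m := by rw [show _ = _ from hB]; trivial
    induction hv using Submodule.iSup_induction' with
    | mem m v hv =>
      refine Submodule.mem_iSup_of_mem (-d i + m) ?_
      rw [mem_weightSpace]
      intro t
      ext a
      rw [hρ, LinearMap.smulRight_apply, map_smul, (mem_weightSpace ρB _ _).1 hv t, hcoord,
        LinearMap.smul_apply, LinearMap.smulRight_apply, smul_smul, smul_smul,
        zpow_add₀ t.ne_zero]
      congr 1
      ring
    | zero => simp
    | add v v' _ _ h h' =>
      have : LinearMap.smulRight (b.coord i) (v + v') =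
          LinearMap.smulRight (b.coord i) v + LinearMap.smulRight (b.coord i) v' := by
        ext; simp
      rw [this]
      exact Submodule.add_mem _ h h'
  refine top_le_iff.1 fun h _ => ?_
  have : h = ∑ i, LinearMap.smulRight (b.coord i) (h (b i)) := by
    classical
    refine b.ext fun j => ?_
    simp [LinearMap.sum_apply, Finsupp.single_apply]
  rw [this]
  exact Submodule.sum_mem _ fun i _ => key i _

/-- Evaluation of a Laurent polynomial at a real number. -/
def evalLaurent (t : ℝˣ) : ℤ[T;T⁻¹] →+* ℝ := LaurentPolynomial.eval₂ (Int.castRingHom ℝ) t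

lemma evalLaurent_T (t : ℝˣ) (n : ℤ) : evalLaurent t (LaurentPolynomial.T n) = (t : ℝ) ^ n := by
  simp [evalLaurent, LaurentPolynomial.eval₂_T]

lemma evalLaurent_C (t : ℝˣ) (n : ℤ) : evalLaurent t (LaurentPolynomial.C n) = n := by
  simp [evalLaurent]

lemma evalLaurent_invert (t : ℝˣ) (p : ℤ[T;T⁻¹]) :
    evalLaurent t (LaurentPolynomial.invert p) = evalLaurent t⁻¹ p := by
  induction p using LaurentPolynomial.induction_on' with
  | add p q hp hq => simp [hp, hq]
  | C_mul_T n a => simp [evalLaurent_T]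

/-- A power of T clears denominators, leaving an ordinary polynomial that vanishes at every nonzero
real. -/
lemma ext_of_evalLaurent {p q : ℤ[T;T⁻¹]} (h : ∀ t, evalLaurent t p = evalLaurent t q) :
    p = q := by
  rw [← sub_eq_zero]
  set r := p - q
  have hr : ∀ t, evalLaurent t r = 0 := fun t => by rw [map_sub, h, sub_self]
  obtain ⟨n, f, hf⟩ := LaurentPolynomial.exists_T_pow r
  have hf0 : f.map (Int.castRingHom ℝ) = 0 := by
    refine Polynomial.eq_zero_of_infinite_isRoot _ ((Set.finite_singleton (0 : ℝ)).infinite_compl.mono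
      fun x hx => ?_)
    have h1 := congrArg (evalLaurent (Units.mk0 x hx)) hf
    rw [map_mul, hr, zero_mul, evalLaurent, LaurentPolynomial.eval₂_toLaurent] at h1
    rw [Set.mem_ofPred_eq, Polynomial.IsRoot, Polynomial.eval_map]
    exact h1
  have hf1 : f = 0 := Polynomial.map_injective _ Int.cast_injective (by simpa using hf0)
  rw [hf1, map_zero] at hf
  have := congrArg (· * LaurentPolynomial.T (-n)) hf
  rw [zero_mul, mul_assoc, ← LaurentPolynomial.T_add, add_neg_cancel, LaurentPolynomial.T_zero,
    mul_one] at this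
  exact this.symm

/-- On V_m the operator is the scalar t^m, so its trace there is dim V_m · t^m; finite dimension
leaves only finitely many nonzero V_m. -/
lemma IsFiniteTorusRep.evalLaurent_tr {ρ : ℝˣ → V →ₗ[ℝ] V} (h : IsFiniteTorusRep ρ) (t : ℝˣ) :
    evalLaurent t (tr ρ) = LinearMap.trace ℝ V (ρ t) := by
  have := h.1
  have hfin : {m | weightSpace ρ m ≠ ⊥}.Finite :=
    WellFoundedGT.finite_ne_bot_of_iSupIndep (iSupIndep_weightSpace ρ)
  have hmaps : ∀ m, Set.MapsTo (ρ t) (weightSpace ρ m) (weightSpace ρ m) := by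
    intro m v hv
    rw [(mem_weightSpace ρ m v).1 hv t]
    exact Submodule.smul_mem _ _ hv
  rw [LinearMap.trace_eq_sum_trace_restrict' h.2 hfin hmaps, tr,
    finsum_eq_sum_of_support_subset (s := hfin.toFinset), map_sum]
  · refine Finset.sum_congr rfl fun m _ => ?_
    have : (ρ t).restrict (hmaps m) = ((t : ℝ) ^ m) • LinearMap.id := by
      ext v
      exact (mem_weightSpace ρ m v).1 v.2 t
    rw [this, map_smul, LinearMap.trace_id, map_mul, evalLaurent_C, evalLaurent_T, smul_eq_mul,
      mul_comm]
    simp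
  · intro m hm
    rw [Finset.mem_coe, Set.Finite.mem_toFinset]
    rintro h0
    rw [Function.mem_support, h0] at hm
    simp at hm

end Weights

/-! ### Long exact sequences of `Ext` with torus action -/

open Abelian

/-- `Extⁿ_R(L, N)`. -/
abbrev ExtR (L N : Type) [AddCommGroup L] [Module R L] [AddCommGroup N] [Module R N] (n : ℕ) :
    Type := Ext.{0} (ModuleCat.of R L) (ModuleCat.of R N) n

section LongExact

variable {w : Fin 3 → ℤ} {L L' L₁ L₂ L₃ N : Type}
  [AddCommGroup L] [Module R L] [AddCommGroup L'] [Module R L']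
  [AddCommGroup L₁] [Module R L₁] [AddCommGroup L₂] [Module R L₂]
  [AddCommGroup L₃] [Module R L₃] [AddCommGroup N] [Module R N]

/-- Homomorphisms as elements of `Ext⁰`. -/
def homToExt : (L →ₗ[R] N) ≃+ ExtR L N 0 :=
  (ModuleCat.homAddEquiv (M := ModuleCat.of R L) (N := ModuleCat.of R N)).symm.trans
    Ext.addEquiv₀.symm

lemma homToExt_apply (h : L →ₗ[R] N) :
    homToExt h = Ext.mk₀ (ModuleCat.ofHom h) := rfl

lemma homToExt_smul (r : ℝ) (h : L →ₗ[R] N) :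
    homToExt ((C r : R) • h) = r • homToExt h := by
  rw [homToExt_apply, homToExt_apply, ← Ext.mk₀_smul]
  rfl

lemma TorusAction.ext_homToExt (A : TorusAction w L) (B : TorusAction w N) (t : ℝˣ)
    (h : L →ₗ[R] N) : A.ext B 0 t (homToExt h) = homToExt (A.homAct B t h) :=
  A.ext_mk₀ B t h

lemma subsingleton_extR_of_projective [Module.Projective R L] (n : ℕ) :
    Subsingleton (ExtR L N (n + 1)) := by
  have : Projective (ModuleCat.of R L) := (IsProjective.iff_projective L).1 inferInstance
  exact Ext.subsingleton_of_projective _ _ n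

/-- Precomposition with a homomorphism. -/
def extPre (h : L →ₗ[R] L') (N : Type) [AddCommGroup N] [Module R N] (n : ℕ) :
    ExtR L' N n →ₗ[ℝ] ExtR L N n :=
  (Ext.mk₀ (ModuleCat.ofHom h)).precompOfLinear ℝ (ModuleCat.of R N) (zero_add n)

/-- Postcomposition with a homomorphism. -/
def extPost (N : Type) [AddCommGroup N] [Module R N] (h : L →ₗ[R] L') (n : ℕ) :
    ExtR N L n →ₗ[ℝ] ExtR N L' n :=
  (Ext.mk₀ (ModuleCat.ofHom h)).postcompOfLinear ℝ (ModuleCat.of R N) (add_zero n)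

lemma extPre_apply (h : L →ₗ[R] L') (n : ℕ) (e : ExtR L' N n) :
    extPre h N n e = (Ext.mk₀ (ModuleCat.ofHom h)).comp e (zero_add n) := rfl

lemma extPost_apply (h : L →ₗ[R] L') (n : ℕ) (e : ExtR N L n) :
    extPost N h n e = e.comp (Ext.mk₀ (ModuleCat.ofHom h)) (add_zero n) := rfl

lemma extPre_homToExt (h : L →ₗ[R] L') (h' : L' →ₗ[R] N) :
    extPre h N 0 (homToExt h') = homToExt (h' ∘ₗ h) := by
  rw [extPre_apply, homToExt_apply, homToExt_apply, Ext.mk₀_comp_mk₀]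
  rfl

lemma TorusAction.IsEquivariant.extPre {A : TorusAction w L} {A' : TorusAction w L'}
    {h : L →ₗ[R] L'} (hh : A.IsEquivariant A' h) (B : TorusAction w N) (n : ℕ) (t : ℝˣ)
    (e : ExtR L' N n) : extPre h N n (A'.ext B n t e) = A.ext B n t (extPre h N n e) := by
  rw [extPre_apply, extPre_apply, A.ext_comp A' B, hh.ext_mk₀]

lemma TorusAction.IsEquivariant.extPost {A : TorusAction w L} {A' : TorusAction w L'}
    {h : L →ₗ[R] L'} (hh : A.IsEquivariant A' h) (B : TorusAction w N) (n : ℕ) (t : ℝˣ)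
    (e : ExtR N L n) : extPost N h n (B.ext A n t e) = B.ext A' n t (extPost N h n e) := by
  rw [extPost_apply, extPost_apply, B.ext_comp A A', hh.ext_mk₀]

variable {f : L₁ →ₗ[R] L₂} {g : L₂ →ₗ[R] L₃} (h : Function.Exact f g)
    (hf : Function.Injective f) (hg : Function.Surjective g)

/-- The contravariant connecting map. -/
def extPreδ (N : Type) [AddCommGroup N] [Module R N] (n : ℕ) :
    ExtR L₁ N n →ₗ[ℝ] ExtR L₃ N (n + 1) :=
  (TorusAction.sesClass h hf hg).precompOfLinear ℝ (ModuleCat.of R N) (add_comm 1 n)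

/-- The covariant connecting map. -/
def extPostδ (N : Type) [AddCommGroup N] [Module R N] (n : ℕ) :
    ExtR N L₃ n →ₗ[ℝ] ExtR N L₁ (n + 1) :=
  (TorusAction.sesClass h hf hg).postcompOfLinear ℝ (ModuleCat.of R N) rfl

lemma extPreδ_apply (n : ℕ) (e : ExtR L₁ N n) :
    extPreδ h hf hg N n e = (TorusAction.sesClass h hf hg).comp e (add_comm 1 n) := rfl

lemma extPostδ_apply (n : ℕ) (e : ExtR N L₃ n) :
    extPostδ h hf hg N n e = e.comp (TorusAction.sesClass h hf hg) rfl := rfl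

include h hf hg in
lemma exact_extPre (n : ℕ) : Function.Exact (extPre g N n) (extPre f N n) := by
  intro x
  constructor
  · intro hx
    exact Ext.contravariant_sequence_exact₂ (TorusAction.ses_shortExact h hf hg) _ x hx
  · rintro ⟨y, rfl⟩
    rw [extPre_apply, extPre_apply, Ext.mk₀_comp_mk₀_assoc]
    have : ModuleCat.ofHom f ≫ ModuleCat.ofHom g = 0 := (TorusAction.ses f g h).zero
    rw [this, Ext.mk₀_zero, Ext.zero_comp]

lemma exact_extPre_extPreδ (n : ℕ) : Function.Exact (extPre f N n) (extPreδ h hf hg N n) := by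
  intro x
  constructor
  · intro hx
    exact Ext.contravariant_sequence_exact₁ (TorusAction.ses_shortExact h hf hg) _ x
      (add_comm 1 n) hx
  · rintro ⟨y, rfl⟩
    exact (TorusAction.ses_shortExact h hf hg).extClass_comp_assoc y (h := add_comm 1 n)

lemma exact_extPreδ_extPre (n : ℕ) :
    Function.Exact (extPreδ h hf hg N n) (extPre g N (n + 1)) := by
  intro x
  constructor
  · intro hx
    exact Ext.contravariant_sequence_exact₃ (TorusAction.ses_shortExact h hf hg) _ x hx
      (add_comm 1 n)
  · rintro ⟨y, rfl⟩
    exact (TorusAction.ses_shortExact h hf hg).comp_extClass_assoc y (add_comm 1 n)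

include hg in
lemma injective_extPre_zero : Function.Injective (extPre g N 0) := by
  have : Epi (ModuleCat.ofHom g) := (ModuleCat.epi_iff_surjective _).2 hg
  exact Ext.precomp_mk₀_injective_of_epi _ (ModuleCat.ofHom g)

include h hf hg in
lemma exact_extPost (n : ℕ) : Function.Exact (extPost N f n) (extPost N g n) := by
  intro x
  constructor
  · intro hx
    exact Ext.covariant_sequence_exact₂ _ (TorusAction.ses_shortExact h hf hg) x hx
  · rintro ⟨y, rfl⟩
    rw [extPost_apply, extPost_apply, Ext.comp_assoc_of_second_deg_zero, Ext.mk₀_comp_mk₀]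
    have : ModuleCat.ofHom f ≫ ModuleCat.ofHom g = 0 := (TorusAction.ses f g h).zero
    rw [this, Ext.mk₀_zero, Ext.comp_zero]

lemma exact_extPost_extPostδ (n : ℕ) :
    Function.Exact (extPost N g n) (extPostδ h hf hg N n) := by
  intro x
  constructor
  · intro hx
    exact Ext.covariant_sequence_exact₃ _ (TorusAction.ses_shortExact h hf hg) x rfl hx
  · rintro ⟨y, rfl⟩
    rw [extPostδ_apply, extPost_apply, Ext.comp_assoc_of_second_deg_zero]
    have := (TorusAction.ses_shortExact h hf hg).comp_extClass
    exact (congrArg (fun z => y.comp z rfl) this).trans (Ext.comp_zero _ _ _ _ _)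

lemma exact_extPostδ_extPost (n : ℕ) :
    Function.Exact (extPostδ h hf hg N n) (extPost N f (n + 1)) := by
  intro x
  constructor
  · intro hx
    exact Ext.covariant_sequence_exact₁ _ (TorusAction.ses_shortExact h hf hg) x hx rfl
  · rintro ⟨y, rfl⟩
    rw [extPostδ_apply, extPost_apply, Ext.comp_assoc_of_third_deg_zero]
    have := (TorusAction.ses_shortExact h hf hg).extClass_comp
    exact (congrArg (fun z => y.comp z rfl) this).trans (Ext.comp_zero _ _ _ _ _)

include hf in
lemma injective_extPost_zero : Function.Injective (extPost N f 0) := by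
  have : Mono (ModuleCat.ofHom f) := (ModuleCat.mono_iff_injective _).2 hf
  exact Ext.postcomp_mk₀_injective_of_mono _ (ModuleCat.ofHom f)

variable {A₁ : TorusAction w L₁} {A₂ : TorusAction w L₂} {A₃ : TorusAction w L₃}
  (ef : A₁.IsEquivariant A₂ f) (eg : A₂.IsEquivariant A₃ g) (B : TorusAction w N)

include ef eg in
lemma extPreδ_ext (n : ℕ) (t : ℝˣ) (e : ExtR L₁ N n) :
    extPreδ h hf hg N n (A₁.ext B n t e) = A₃.ext B (n + 1) t (extPreδ h hf hg N n e) := by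
  rw [extPreδ_apply, extPreδ_apply, A₃.ext_comp A₁ B,
    TorusAction.ext_sesClass h hf hg ef eg]

include ef eg in
lemma extPostδ_ext (n : ℕ) (t : ℝˣ) (e : ExtR N L₃ n) :
    extPostδ h hf hg N n (B.ext A₃ n t e) = B.ext A₁ (n + 1) t (extPostδ h hf hg N n e) := by
  rw [extPostδ_apply, extPostδ_apply, B.ext_comp A₃ A₁,
    TorusAction.ext_sesClass h hf hg ef eg]

/-- Naturality of the contravariant connecting map. -/
lemma extPre_extPreδ (u₁ : L₁ →ₗ[R] L₁) (u₂ : L₂ →ₗ[R] L₂) (u₃ : L₃ →ₗ[R] L₃)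
    (h₁ : f ∘ₗ u₁ = u₂ ∘ₗ f) (h₂ : g ∘ₗ u₂ = u₃ ∘ₗ g) (n : ℕ) (e : ExtR L₁ N n) :
    extPre u₃ N (n + 1) (extPreδ h hf hg N n e) =
      extPreδ h hf hg N n (extPre u₁ N n e) := by
  have hS := TorusAction.ses_shortExact h hf hg
  have := ShortComplex.ShortExact.extClass_naturality hS hS
    { τ₁ := ModuleCat.ofHom u₁, τ₂ := ModuleCat.ofHom u₂, τ₃ := ModuleCat.ofHom u₃,
      comm₁₂ := congrArg ModuleCat.ofHom h₁
      comm₂₃ := congrArg ModuleCat.ofHom h₂ }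
  have h3 := congrArg (fun z => Ext.comp z e (add_comm 1 n)) this
  rw [extPre_apply, extPreδ_apply, extPre_apply, extPreδ_apply]
  refine (Ext.comp_assoc _ _ _ _ _ (by omega)).symm.trans (h3.symm.trans ?_)
  exact Ext.comp_assoc_of_second_deg_zero _ _ _ _

/-- The alternating sum of the traces of `t` on `Extⁿ(L, N)`, `n < 4`. -/
def eulerTrace (A : TorusAction w L) (B : TorusAction w N) (t : ℝˣ) : ℝ :=
  ∑ n ∈ Finset.range 4, (-1) ^ n * LinearMap.trace ℝ _ (A.ext B n t)

include h hf hg in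
lemma subsingleton_extR_of_shortExact (n : ℕ) [Subsingleton (ExtR L₁ N n)]
    [Subsingleton (ExtR L₂ N (n + 1))] : Subsingleton (ExtR L₃ N (n + 1)) := by
  refine subsingleton_of_forall_eq 0 fun x => ?_
  obtain ⟨y, rfl⟩ := (exact_extPreδ_extPre h hf hg (N := N) n x).1 (Subsingleton.elim _ _)
  rw [Subsingleton.elim y 0, map_zero]

include h hf hg in
lemma finite_extR_of_shortExact [∀ n, FiniteDimensional ℝ (ExtR L₁ N n)]
    [∀ n, FiniteDimensional ℝ (ExtR L₂ N n)] (n : ℕ) : FiniteDimensional ℝ (ExtR L₃ N n) := by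
  cases n with
  | zero => exact FiniteDimensional.of_injective _ (injective_extPre_zero (N := N) hg)
  | succ n => exact finiteDimensional_of_exact (exact_extPreδ_extPre h hf hg (N := N) n)

/-- The sub-object is `L` with its action scaled by `c`, so additivity of the Euler trace reads χ(L)
= χ(L₃) + c⁻¹ χ(L). -/
lemma eulerTrace_of_shortExact {u : L →ₗ[R] L} {v : L →ₗ[R] L₃} (h : Function.Exact u v)
    (hu : Function.Injective u) (hv : Function.Surjective v) {A : TorusAction w L}
    {c : ℝˣ →* ℝˣ} (eu : (A.scale c).IsEquivariant A u) (ev : A.IsEquivariant A₃ v)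
    (B : TorusAction w N) [∀ n, FiniteDimensional ℝ (ExtR L N n)] [Subsingleton (ExtR L N 3)]
    (t : ℝˣ) : eulerTrace A₃ B t = (1 - ((c t)⁻¹ : ℝˣ)) * eulerTrace A B t := by
  have := finite_extR_of_shortExact h hu hv (N := N)
  have key := sum_trace_of_longExact (k := ℝ) (fun n => extPre v N n) (fun n => extPre u N n)
    (fun n => extPreδ h hu hv N n) (fun n => A₃.ext B n t) (fun n => A.ext B n t)
    (fun n => (A.scale c).ext B n t) (fun n => ev.extPre B n t) (fun n => eu.extPre B n t)
    (fun n => extPreδ_ext h hu hv eu ev B n t) (injective_extPre_zero hv)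
    (fun n => exact_extPre h hu hv n) (fun n => exact_extPre_extPreδ h hu hv n)
    -- Cutting the sequence after degree 3 is harmless: the next connecting map starts at Ext³(L, N)
    -- = 0.
    (fun n => exact_extPreδ_extPre h hu hv n) 3 (by
      ext x
      rw [Subsingleton.elim x 0, map_zero, map_zero])
  simp only [TorusAction.scale_ext, map_smul, smul_eq_mul] at key
  unfold eulerTrace
  simp only [Finset.sum_range_succ, Finset.sum_range_zero] at key ⊢
  linear_combination key

end LongExact

/-! ### The Koszul operators on `R ⊗ W` -/

open TensorProduct

section Koszul

variable (W : Type) [AddCommGroup W] [Module R W] [Module ℝ W] [IsScalarTower ℝ R W]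

/-- The operator `x_i ⊗ 1 - 1 ⊗ x_i` on `R ⊗ W`. -/
def koszul (i : Fin 3) : R ⊗[ℝ] W →ₗ[R] R ⊗[ℝ] W :=
  (X i : R) • LinearMap.id - (Algebra.lsmul ℝ ℝ W (X i : R)).baseChange R

variable {W}

lemma koszul_tmul (i : Fin 3) (r : R) (m : W) :
    koszul W i (r ⊗ₜ m) = (X i * r) ⊗ₜ m - r ⊗ₜ ((X i : R) • m) := by
  simp [koszul, TensorProduct.smul_tmul']

lemma koszul_comm (i j : Fin 3) (z : R ⊗[ℝ] W) :
    koszul W i (koszul W j z) = koszul W j (koszul W i z) := by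
  induction z with
  | zero => simp
  | add z z' h h' => simp [h, h']
  | tmul r m =>
    simp only [koszul_tmul, map_sub, smul_smul, mul_comm (X i : R) (X j), mul_left_comm (X i : R)]
    abel

omit [Module R W] [IsScalarTower ℝ R W] in
lemma linearMap_ext_monomial {V : Type*} [AddCommGroup V] [Module ℝ V]
    {f g : R ⊗[ℝ] W →ₗ[ℝ] V}
    (h : ∀ (a : Fin 3 →₀ ℕ) (m : W), f (monomial a 1 ⊗ₜ m) = g (monomial a 1 ⊗ₜ m)) : f = g := by
  refine TensorProduct.ext ((basisMonomials (Fin 3) ℝ).ext fun a => ?_)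
  ext m
  simpa using h a m

variable (W) in
/-- Division by `x_i ⊗ 1 - 1 ⊗ x_i`, the left inverse of `koszul`. -/
def koszulDiv (i : Fin 3) : R ⊗[ℝ] W →ₗ[ℝ] R ⊗[ℝ] W :=
  TensorProduct.lift ((basisMonomials (Fin 3) ℝ).constr ℝ fun a =>
    ∑ k ∈ Finset.range (a i), TensorProduct.mk ℝ R W (monomial (a - Finsupp.single i (k + 1)) 1) ∘ₗ
      Algebra.lsmul ℝ ℝ W (X i ^ k : R))

/-- The sum is the quotient (xⁿ - yⁿ)/(x - y) = ∑ xⁿ⁻¹⁻ᵏ yᵏ, with x = xᵢ ⊗ 1, y = 1 ⊗ xᵢ and n the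
exponent of xᵢ in the monomial. -/
lemma koszulDiv_tmul (i : Fin 3) (a : Fin 3 →₀ ℕ) (m : W) :
    koszulDiv W i (monomial a 1 ⊗ₜ m) = ∑ k ∈ Finset.range (a i),
      monomial (a - Finsupp.single i (k + 1)) 1 ⊗ₜ ((X i ^ k : R) • m) := by
  have : (monomial a 1 : R) = basisMonomials (Fin 3) ℝ a := by simp
  rw [this, koszulDiv, TensorProduct.lift.tmul, Module.Basis.constr_basis]
  simp [-map_pow]

lemma X_mul_monomial_one (i : Fin 3) (a : Fin 3 →₀ ℕ) :
    (X i * monomial a 1 : R) = monomial (a + Finsupp.single i 1) 1 := by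
  rw [X, monomial_mul, add_comm, one_mul]

lemma koszulDiv_koszul (i : Fin 3) (z : R ⊗[ℝ] W) : koszulDiv W i (koszul W i z) = z := by
  have : koszulDiv W i ∘ₗ (koszul W i).restrictScalars ℝ = LinearMap.id := by
    refine linearMap_ext_monomial fun a m => ?_
    rw [LinearMap.comp_apply, LinearMap.restrictScalars_apply, koszul_tmul, map_sub,
      X_mul_monomial_one, koszulDiv_tmul, koszulDiv_tmul, LinearMap.id_apply]
    simp only [Finsupp.add_apply, Finsupp.single_eq_same]
    -- Separating the term k = 0, which is the original tensor, makes the remaining terms cancel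
    -- against the second sum.
    rw [Finset.sum_range_succ']
    simp only [zero_add, pow_zero, one_smul, add_tsub_cancel_right]
    rw [add_sub_right_comm, sub_eq_zero.2, zero_add]
    refine Finset.sum_congr rfl fun k _ => ?_
    rw [pow_succ, mul_smul, Finsupp.single_add i (k + 1) 1, add_tsub_add_eq_tsub_right]
  exact LinearMap.congr_fun this z

/-- On the left factor the two maps change exponents of different variables; on `W` they act by
commuting powers of variables. This commutation yields regularity. -/
lemma koszulDiv_koszul_comm {i j : Fin 3} (hij : i ≠ j) (z : R ⊗[ℝ] W) :
    koszulDiv W i (koszul W j z) = koszul W j (koszulDiv W i z) := by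
  have : koszulDiv W i ∘ₗ (koszul W j).restrictScalars ℝ =
      (koszul W j).restrictScalars ℝ ∘ₗ koszulDiv W i := by
    refine linearMap_ext_monomial fun a m => ?_
    simp only [LinearMap.comp_apply, LinearMap.restrictScalars_apply, koszul_tmul, map_sub,
      X_mul_monomial_one, koszulDiv_tmul, map_sum, Finset.sum_sub_distrib, smul_smul]
    have ha : (a + Finsupp.single j 1 : Fin 3 →₀ ℕ) i = a i := by simp [hij.symm]
    rw [ha]
    congr 1
    · refine Finset.sum_congr rfl fun k hk => ?_
      congr 2
      -- The truncated subtraction is genuine here because k < a i.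
      rw [tsub_add_eq_add_tsub]
      rw [Finsupp.single_le_iff]
      exact Finset.mem_range.1 hk
    · refine Finset.sum_congr rfl fun k _ => ?_
      rw [mul_comm]
  exact LinearMap.congr_fun this z

lemma koszul_injective (i : Fin 3) : Function.Injective (koszul W i) :=
  Function.LeftInverse.injective (koszulDiv_koszul i)

/-- With κᵢ the operators and D₀ division by κ₀, one has κ₁κ₀D₀z = κ₀D₀κ₁z = κ₀D₀κ₀u = κ₀u = κ₁z,
and κ₁ is injective. -/
lemma koszul_one_regular {z u : R ⊗[ℝ] W} (h : koszul W 1 z = koszul W 0 u) :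
    ∃ u', z = koszul W 0 u' := by
  refine ⟨koszulDiv W 0 z, koszul_injective 1 ?_⟩
  rw [koszul_comm, ← koszulDiv_koszul_comm (by decide), h, koszulDiv_koszul]

lemma koszul_two_regular {z u v : R ⊗[ℝ] W}
    (h : koszul W 2 z = koszul W 0 u + koszul W 1 v) :
    ∃ u' v', z = koszul W 0 u' + koszul W 1 v' := by
  -- The projection p = 1 - κ₀D₀ kills the image of κ₀ and commutes with κ₁ and κ₂, so it reduces
  -- the claim to the argument for two operators.
  let p : R ⊗[ℝ] W → R ⊗[ℝ] W := fun z => z - koszul W 0 (koszulDiv W 0 z)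
  have hp : ∀ i z, i ≠ 0 → p (koszul W i z) = koszul W i (p z) := by
    intro i z hi
    simp only [p, map_sub]
    rw [koszulDiv_koszul_comm hi.symm, koszul_comm]
  have h1 : koszul W 2 (p z) = koszul W 1 (p v) := by
    rw [← hp _ _ (by decide), ← hp _ _ (by decide), h]
    simp only [p, map_add, koszulDiv_koszul]
    abel
  have h2 : p z = koszul W 1 (koszulDiv W 1 (p z)) := by
    apply koszul_injective 2
    rw [koszul_comm, ← koszulDiv_koszul_comm (by decide), h1, koszulDiv_koszul]
  exact ⟨koszulDiv W 0 z, koszulDiv W 1 (p z), by rw [← h2]; simp [p]⟩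

variable (W) in
/-- The action map `R ⊗ W → W`. -/
def koszulAug : R ⊗[ℝ] W →ₗ[R] W := TensorProduct.AlgebraTensorModule.lift
  { toFun := fun r => r • LinearMap.id
    map_add' := fun _ _ => add_smul _ _ _
    map_smul' := fun _ _ => mul_smul _ _ _ }

lemma koszulAug_tmul (r : R) (m : W) : koszulAug W (r ⊗ₜ m) = r • m := by
  simp [koszulAug]

lemma koszulAug_koszul (i : Fin 3) (z : R ⊗[ℝ] W) : koszulAug W (koszul W i z) = 0 := by
  induction z with
  | zero => simp
  | add z z' h h' => simp [h, h']
  | tmul r m => simp [koszul_tmul, koszulAug_tmul, smul_smul, mul_comm]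

lemma koszulAug_surjective : Function.Surjective (koszulAug W) :=
  fun m => ⟨1 ⊗ₜ m, by simp [koszulAug_tmul]⟩

/-- Modulo the images of the κᵢ, factors of R can be moved across the tensor sign, so every z is
congruent to 1 ⊗ (augmentation of z). -/
lemma exists_eq_of_koszulAug_eq_zero {z : R ⊗[ℝ] W} (h : koszulAug W z = 0) :
    ∃ u : Fin 3 → R ⊗[ℝ] W, z = ∑ i, koszul W i (u i) := by
  let P : AddSubgroup (R ⊗[ℝ] W) := ⨆ i, (koszul W i).toAddMonoidHom.range
  have hP : ∀ i z, koszul W i z ∈ P := fun i z =>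
    (le_iSup (fun i => (koszul W i).toAddMonoidHom.range) i) ⟨z, rfl⟩
  have key : ∀ (r : R) (m : W), r ⊗ₜ m - 1 ⊗ₜ (r • m) ∈ P := by
    intro r
    induction r using MvPolynomial.induction_on with
    | C a =>
      intro m
      have : (C a : R) ⊗ₜ[ℝ] m = 1 ⊗ₜ ((C a : R) • m) := by
        rw [← algebraMap_eq, algebraMap_smul, Algebra.algebraMap_eq_smul_one, smul_tmul]
      rw [this, sub_self]
      exact P.zero_mem
    | add p q hp hq =>
      intro m
      rw [add_tmul, add_smul, tmul_add, add_sub_add_comm]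
      exact P.add_mem (hp m) (hq m)
    | mul_X p i hp =>
      intro m
      have h1 := P.add_mem (hP i (p ⊗ₜ m)) (hp ((X i : R) • m))
      rw [koszul_tmul, sub_add_sub_cancel, mul_comm (X i) p, smul_smul] at h1
      exact h1
  have hz : z - 1 ⊗ₜ koszulAug W z ∈ P := by
    clear h
    induction z with
    | zero => simp [P.zero_mem]
    | add z z' h h' =>
      rw [map_add, tmul_add, add_sub_add_comm]
      exact P.add_mem h h'
    | tmul r m =>
      rw [koszulAug_tmul]
      exact key r m
  rw [h, tmul_zero, sub_zero] at hz
  clear h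
  induction hz using AddSubgroup.iSup_induction' with
  | hp i x hx =>
    obtain ⟨u, rfl⟩ := hx
    refine ⟨Pi.single i u, ?_⟩
    rw [Finset.sum_eq_single i]
    · simp
    · intro j _ hj
      simp [Pi.single_eq_of_ne hj]
    · simp
  | h1 => exact ⟨0, by simp⟩
  | hadd x y _ _ hx hy =>
    obtain ⟨u, rfl⟩ := hx
    obtain ⟨v, rfl⟩ := hy
    exact ⟨u + v, by simp [Finset.sum_add_distrib]⟩

end Koszul

/-! ### The tower of cokernels of the Koszul operators -/

open TensorProduct

section Coker

variable {w : Fin 3 → ℤ} {L : Type} [AddCommGroup L] [Module R L]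

/-- The map induced on the cokernel of `u` by a map commuting with `u`. -/
def cokerMap (u y : L →ₗ[R] L) (hy : ∀ l, y (u l) = u (y l)) :
    (L ⧸ LinearMap.range u) →ₗ[R] (L ⧸ LinearMap.range u) :=
  (LinearMap.range u).mapQ (LinearMap.range u) y (by
    rintro _ ⟨l, rfl⟩
    exact ⟨y l, (hy l).symm⟩)

lemma cokerMap_comp_mkQ (u y : L →ₗ[R] L) (hy : ∀ l, y (u l) = u (y l)) :
    (LinearMap.range u).mkQ ∘ₗ y = cokerMap u y hy ∘ₗ (LinearMap.range u).mkQ := rfl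

/-- The action on the cokernel of an endomorphism that is equivariant up to a character. -/
def TorusAction.coker (A : TorusAction w L) {u : L →ₗ[R] L} {c : ℝˣ →* ℝˣ}
    (hu : (A.scale c).IsEquivariant A u) : TorusAction w (L ⧸ LinearMap.range u) where
  act t := QuotientAddGroup.map (LinearMap.range u).toAddSubgroup
    (LinearMap.range u).toAddSubgroup (A.act t) (by
      rintro _ ⟨l, rfl⟩
      exact ⟨_, hu t l⟩)
  act_smul t r l := by
    obtain ⟨l, rfl⟩ := Submodule.Quotient.mk_surjective _ l
    exact congrArg Submodule.Quotient.mk (A.act_smul t r l)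
  act_act_inv t l := by
    obtain ⟨l, rfl⟩ := Submodule.Quotient.mk_surjective _ l
    exact congrArg Submodule.Quotient.mk (A.act_act_inv t l)

variable {A : TorusAction w L} {u : L →ₗ[R] L} {c c' : ℝˣ →* ℝˣ}
  (hu : (A.scale c).IsEquivariant A u)

lemma isEquivariant_mkQ : A.IsEquivariant (A.coker hu) (LinearMap.range u).mkQ :=
  fun _ _ => rfl

lemma isEquivariant_cokerMap {y : L →ₗ[R] L} (hy : ∀ l, y (u l) = u (y l))
    (ey : (A.scale c').IsEquivariant A y) :
    ((A.coker hu).scale c').IsEquivariant (A.coker hu) (cokerMap u y hy) := by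
  intro t l
  obtain ⟨l, rfl⟩ := Submodule.Quotient.mk_surjective _ l
  exact congrArg Submodule.Quotient.mk (ey t l)

lemma exact_mkQ (u : L →ₗ[R] L) : Function.Exact u (LinearMap.range u).mkQ :=
  LinearMap.exact_map_mkQ_range u

end Coker

section Tower

variable {w : Fin 3 → ℤ} {M : Type} [AddCommGroup M] [Module R M] [Module ℝ M]
  [IsScalarTower ℝ R M]

/-- The action of the torus as a linear map over `ℝ`. -/
def TorusAction.lin (A : TorusAction w M) (t : ℝˣ) : M →ₗ[ℝ] M where
  toFun := A.act t
  map_add' := map_add _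
  map_smul' r m := by
    rw [← algebraMap_smul R r m, A.act_smul, AlgHom.commutes, algebraMap_smul, RingHom.id_apply]

lemma TorusAction.lin_apply (A : TorusAction w M) (t : ℝˣ) (m : M) : A.lin t m = A.act t m := rfl

/-- The action of the torus on `R ⊗ M`. -/
def TorusAction.free (A : TorusAction w M) : TorusAction w (R ⊗[ℝ] M) where
  act t := (TensorProduct.map (torusAct w t).toLinearMap (A.lin t)).toAddMonoidHom
  act_smul t r z := by
    induction z with
    | zero => simp
    | add z z' h h' => rw [smul_add, map_add, h, h', map_add, smul_add]
    | tmul s m => simp [TensorProduct.smul_tmul', map_mul]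
  act_act_inv t z := by
    induction z with
    | zero => simp
    | add z z' h h' => rw [map_add, map_add, h, h']
    | tmul s m => simp [TorusAction.lin_apply, torusAct_mul_inv, A.act_act_inv]

lemma TorusAction.free_act_tmul (A : TorusAction w M) (t : ℝˣ) (r : R) (m : M) :
    A.free.act t (r ⊗ₜ m) = torusAct w t r ⊗ₜ A.act t m := rfl

variable (w) in
/-- The tangent character `s_i`. -/
def tangentChar (i : Fin 3) : ℝˣ →* ℝˣ := zpowGroupHom (w i)

lemma tangentChar_apply (i : Fin 3) (t : ℝˣ) : (tangentChar w i t : ℝ) = (t : ℝ) ^ w i := by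
  simp [tangentChar]

lemma torusAct_X (t : ℝˣ) (i : Fin 3) :
    torusAct w t (X i) = C (tangentChar w i t : ℝ) * X i := by
  rw [tangentChar_apply, torusAct, aeval_X]

lemma isEquivariant_koszul (A : TorusAction w M) (i : Fin 3) :
    (A.free.scale (tangentChar w i)).IsEquivariant A.free (koszul M i) := by
  intro t z
  rw [TorusAction.scale_act]
  simp only [AddMonoidHom.comp_apply, DistribSMul.toAddMonoidHom_apply, map_smul]
  induction z with
  | zero => simp
  | add z z' h h' => simp only [map_add, smul_add, h, h']
  | tmul r m =>
    simp only [koszul_tmul, map_sub, TorusAction.free_act_tmul, map_mul, torusAct_X,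
      A.act_smul, smul_sub, TensorProduct.smul_tmul', smul_eq_mul, mul_assoc]
    congr 1
    rw [mul_smul, ← algebraMap_eq, algebraMap_smul,
      ← TensorProduct.smul_tmul (tangentChar w i t : ℝ) _ ((X i : R) • A.act t m),
      Algebra.smul_def]

lemma isEquivariant_koszulAug (A : TorusAction w M) :
    A.free.IsEquivariant A (koszulAug M) := by
  intro t z
  induction z with
  | zero => simp
  | add z z' h h' => simp only [map_add, h, h']
  | tmul r m => rw [TorusAction.free_act_tmul, koszulAug_tmul, koszulAug_tmul, A.act_smul]

variable (M) in
/-- The cokernel of the first Koszul operator. -/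
abbrev Tower₁ : Type := (R ⊗[ℝ] M) ⧸ LinearMap.range (koszul M 0)

variable (M) in
/-- The Koszul operators on the first cokernel. -/
def tower₁Map (i : Fin 3) : Tower₁ M →ₗ[R] Tower₁ M :=
  cokerMap (koszul M 0) (koszul M i) (koszul_comm i 0)

variable (M) in
/-- The cokernel of the second Koszul operator on the first cokernel. -/
abbrev Tower₂ : Type := Tower₁ M ⧸ LinearMap.range (tower₁Map M 1)

lemma tower₁Map_comm (i j : Fin 3) (l : Tower₁ M) :
    tower₁Map M i (tower₁Map M j l) = tower₁Map M j (tower₁Map M i l) := by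
  obtain ⟨z, rfl⟩ := Submodule.Quotient.mk_surjective _ l
  exact congrArg Submodule.Quotient.mk (koszul_comm i j z)

variable (M) in
/-- The third Koszul operator on the second cokernel. -/
def tower₂Map : Tower₂ M →ₗ[R] Tower₂ M :=
  cokerMap (tower₁Map M 1) (tower₁Map M 2) (tower₁Map_comm 2 1)

/-- This is `koszul_one_regular` read in the quotient; `tower₂Map_injective` reads
`koszul_two_regular` in the same way. -/
lemma tower₁Map_injective : Function.Injective (tower₁Map M 1) := by
  rw [injective_iff_map_eq_zero]
  intro l hl
  obtain ⟨z, rfl⟩ := Submodule.Quotient.mk_surjective _ l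
  obtain ⟨u, hu⟩ := (Submodule.Quotient.mk_eq_zero _).1 hl
  obtain ⟨u', hu'⟩ := koszul_one_regular hu.symm
  exact (Submodule.Quotient.mk_eq_zero _).2 ⟨u', hu'.symm⟩

lemma tower₂_mk_eq_zero_iff {z : R ⊗[ℝ] M} :
    (Submodule.Quotient.mk (Submodule.Quotient.mk z : Tower₁ M) : Tower₂ M) = 0 ↔
      ∃ u v, z = koszul M 0 u + koszul M 1 v := by
  rw [Submodule.Quotient.mk_eq_zero]
  constructor
  · rintro ⟨l, hl⟩
    obtain ⟨v, rfl⟩ := Submodule.Quotient.mk_surjective _ l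
    obtain ⟨u, hu⟩ := (Submodule.Quotient.eq _).1 hl.symm
    exact ⟨u, v, by rw [hu, sub_add_cancel]⟩
  · rintro ⟨u, v, rfl⟩
    refine ⟨Submodule.Quotient.mk v, ?_⟩
    refine (Submodule.Quotient.eq _).2 ⟨-u, ?_⟩
    rw [map_neg]
    simp [sub_eq_add_neg]

lemma tower₂Map_injective : Function.Injective (tower₂Map M) := by
  rw [injective_iff_map_eq_zero]
  intro l hl
  obtain ⟨l, rfl⟩ := Submodule.Quotient.mk_surjective _ l
  obtain ⟨z, rfl⟩ := Submodule.Quotient.mk_surjective _ l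
  obtain ⟨u, v, huv⟩ := tower₂_mk_eq_zero_iff.1 hl
  exact tower₂_mk_eq_zero_iff.2 (koszul_two_regular huv)

variable (M) in
/-- The augmentation from the second cokernel to `M`. -/
def tower₂Aug : Tower₂ M →ₗ[R] M :=
  (LinearMap.range (tower₁Map M 1)).liftQ
    ((LinearMap.range (koszul M 0)).liftQ (koszulAug M) (by
      rintro _ ⟨z, rfl⟩
      exact koszulAug_koszul 0 z)) (by
    rintro _ ⟨l, rfl⟩
    obtain ⟨z, rfl⟩ := Submodule.Quotient.mk_surjective _ l
    exact koszulAug_koszul 1 z)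

lemma tower₂Aug_mk (z : R ⊗[ℝ] M) :
    tower₂Aug M (Submodule.Quotient.mk (Submodule.Quotient.mk z)) = koszulAug M z := rfl

lemma tower₂Aug_surjective : Function.Surjective (tower₂Aug M) := by
  intro m
  obtain ⟨z, rfl⟩ := koszulAug_surjective m
  exact ⟨_, tower₂Aug_mk z⟩

lemma exact_tower₂Aug : Function.Exact (tower₂Map M) (tower₂Aug M) := by
  intro l
  constructor
  · intro hl
    obtain ⟨l, rfl⟩ := Submodule.Quotient.mk_surjective _ l
    obtain ⟨z, rfl⟩ := Submodule.Quotient.mk_surjective _ l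
    obtain ⟨u, hu⟩ := exists_eq_of_koszulAug_eq_zero hl
    -- In z = κ₀u₀ + κ₁u₁ + κ₂u₂ the first two terms die in the second cokernel.
    refine ⟨Submodule.Quotient.mk (Submodule.Quotient.mk (u 2)), ?_⟩
    rw [← sub_eq_zero]
    refine tower₂_mk_eq_zero_iff.2 ⟨-u 0, -u 1, ?_⟩
    rw [hu, Fin.sum_univ_three, map_neg, map_neg]
    abel_nf
  · rintro ⟨l, rfl⟩
    obtain ⟨l, rfl⟩ := Submodule.Quotient.mk_surjective _ l
    obtain ⟨z, rfl⟩ := Submodule.Quotient.mk_surjective _ l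
    exact koszulAug_koszul 2 z

variable (A : TorusAction w M)

/-- The action on the first cokernel. -/
def TorusAction.tower₁ : TorusAction w (Tower₁ M) := A.free.coker (isEquivariant_koszul A 0)

lemma isEquivariant_tower₁Map (i : Fin 3) :
    (A.tower₁.scale (tangentChar w i)).IsEquivariant A.tower₁ (tower₁Map M i) :=
  isEquivariant_cokerMap _ _ (isEquivariant_koszul A i)

/-- The action on the second cokernel. -/
def TorusAction.tower₂ : TorusAction w (Tower₂ M) :=
  A.tower₁.coker (isEquivariant_tower₁Map A 1)

lemma isEquivariant_tower₂Map :
    (A.tower₂.scale (tangentChar w 2)).IsEquivariant A.tower₂ (tower₂Map M) :=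
  isEquivariant_cokerMap _ _ (isEquivariant_tower₁Map A 2)

lemma isEquivariant_tower₂Aug : A.tower₂.IsEquivariant A (tower₂Aug M) := by
  intro t l
  obtain ⟨l, rfl⟩ := Submodule.Quotient.mk_surjective _ l
  obtain ⟨z, rfl⟩ := Submodule.Quotient.mk_surjective _ l
  exact isEquivariant_koszulAug A t z

/-! ### Consequences for `Ext` -/

variable {N : Type} [AddCommGroup N] [Module R N]

/-- R ⊗ M is projective, and each quotient by an injective operator raises the projective dimension
by at most one; after three steps Ext vanishes from degree 4 on. -/
instance (n : ℕ) : Subsingleton (ExtR (R ⊗[ℝ] M) N (n + 1)) :=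
  subsingleton_extR_of_projective n

instance (n : ℕ) : Subsingleton (ExtR (Tower₁ M) N (n + 2)) :=
  subsingleton_extR_of_shortExact (exact_mkQ _) (koszul_injective 0)
    (Submodule.mkQ_surjective _) (n + 1)

instance (n : ℕ) : Subsingleton (ExtR (Tower₂ M) N (n + 3)) :=
  subsingleton_extR_of_shortExact (exact_mkQ _) tower₁Map_injective
    (Submodule.mkQ_surjective _) (n + 2)

lemma subsingleton_extR_of_three_lt (n : ℕ) : Subsingleton (ExtR M N (n + 4)) :=
  subsingleton_extR_of_shortExact exact_tower₂Aug tower₂Map_injective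
    tower₂Aug_surjective (n + 3)

/-- Precomposition with the tower of connecting maps, `Hom(R ⊗ M, N) → Ext¹(Tower₁, N)`. -/
def towerδ₁ (M N : Type) [AddCommGroup M] [Module R M] [Module ℝ M] [IsScalarTower ℝ R M]
    [AddCommGroup N] [Module R N] : ExtR (R ⊗[ℝ] M) N 0 →ₗ[ℝ] ExtR (Tower₁ M) N 1 :=
  extPreδ (exact_mkQ _) (koszul_injective 0) (Submodule.mkQ_surjective _) N 0

/-- The connecting map `Ext¹(Tower₁, N) → Ext²(Tower₂, N)`. -/
def towerδ₂ (M N : Type) [AddCommGroup M] [Module R M] [Module ℝ M] [IsScalarTower ℝ R M]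
    [AddCommGroup N] [Module R N] : ExtR (Tower₁ M) N 1 →ₗ[ℝ] ExtR (Tower₂ M) N 2 :=
  extPreδ (exact_mkQ _) tower₁Map_injective (Submodule.mkQ_surjective _) N 1

/-- The connecting map `Ext²(Tower₂, N) → Ext³(M, N)`. -/
def towerδ₃ (M N : Type) [AddCommGroup M] [Module R M] [Module ℝ M] [IsScalarTower ℝ R M]
    [AddCommGroup N] [Module R N] : ExtR (Tower₂ M) N 2 →ₗ[ℝ] ExtR M N 3 :=
  extPreδ exact_tower₂Aug tower₂Map_injective tower₂Aug_surjective N 2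

lemma exact_towerδ₁ : Function.Exact (extPre (koszul M 0) N 0) (towerδ₁ M N) :=
  exact_extPre_extPreδ _ _ _ 0

lemma exact_towerδ₂ : Function.Exact (extPre (tower₁Map M 1) N 1) (towerδ₂ M N) :=
  exact_extPre_extPreδ _ _ _ 1

lemma exact_towerδ₃ : Function.Exact (extPre (tower₂Map M) N 2) (towerδ₃ M N) :=
  exact_extPre_extPreδ _ _ _ 2

lemma towerδ₁_surjective : Function.Surjective (towerδ₁ M N) := fun x =>
  (exact_extPreδ_extPre (exact_mkQ (koszul M 0)) (koszul_injective 0)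
    (Submodule.mkQ_surjective _) 0 x).1 (Subsingleton.elim _ _)

lemma towerδ₂_surjective : Function.Surjective (towerδ₂ M N) := fun x =>
  (exact_extPreδ_extPre (exact_mkQ (tower₁Map M 1)) tower₁Map_injective
    (Submodule.mkQ_surjective _) 1 x).1 (Subsingleton.elim _ _)

lemma towerδ₃_surjective : Function.Surjective (towerδ₃ M N) := fun x =>
  (exact_extPreδ_extPre exact_tower₂Aug tower₂Map_injective
    tower₂Aug_surjective 2 x).1 (Subsingleton.elim _ _)

/-- The operator κᵢ acts on all three terms of the short exact sequence, hence commutes with its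
connecting map. -/
lemma extPre_towerδ₁ (i : Fin 3) (e : ExtR (R ⊗[ℝ] M) N 0) :
    extPre (tower₁Map M i) N 1 (towerδ₁ M N e) = towerδ₁ M N (extPre (koszul M i) N 0 e) :=
  extPre_extPreδ _ _ _ (koszul M i) (koszul M i) (tower₁Map M i)
    (LinearMap.ext (koszul_comm 0 i)) (cokerMap_comp_mkQ _ _ _) 0 e

lemma extPre_towerδ₂ (e : ExtR (Tower₁ M) N 1) :
    extPre (tower₂Map M) N 2 (towerδ₂ M N e) = towerδ₂ M N (extPre (tower₁Map M 2) N 1 e) :=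
  extPre_extPreδ _ _ _ (tower₁Map M 2) (tower₁Map M 2) (tower₂Map M)
    (LinearMap.ext (tower₁Map_comm 1 2)) (cokerMap_comp_mkQ _ _ _) 1 e

/-- The character `s₁ s₂ s₃`. -/
def tangentDet (w : Fin 3 → ℤ) : ℝˣ →* ℝˣ := tangentChar w 0 * tangentChar w 1 * tangentChar w 2

/-- The composite of the connecting maps is equivariant up to the inverse of `s₁ s₂ s₃`. -/
lemma towerδ_ext (B : TorusAction w N) (t : ℝˣ) (e : ExtR (R ⊗[ℝ] M) N 0) :
    A.ext B 3 t (towerδ₃ M N (towerδ₂ M N (towerδ₁ M N e))) = ((tangentDet w t)⁻¹ : ℝˣ).1 •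
      towerδ₃ M N (towerδ₂ M N (towerδ₁ M N (A.free.ext B 0 t e))) := by
  -- Each of the three connecting maps is equivariant from the scaled sub-object, so each
  -- contributes one factor sᵢ⁻¹.
  have h1 := extPreδ_ext (exact_mkQ _) (koszul_injective 0) (Submodule.mkQ_surjective _)
    (isEquivariant_koszul A 0) (isEquivariant_mkQ (isEquivariant_koszul A 0)) B 0 t e
  have h2 := fun e => extPreδ_ext (exact_mkQ _) tower₁Map_injective (Submodule.mkQ_surjective _)
    (isEquivariant_tower₁Map A 1) (isEquivariant_mkQ (isEquivariant_tower₁Map A 1)) B 1 t e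
  have h3 := fun e => extPreδ_ext exact_tower₂Aug tower₂Map_injective tower₂Aug_surjective
    (isEquivariant_tower₂Map A) (isEquivariant_tower₂Aug A) B 2 t e
  rw [TorusAction.scale_ext, LinearMap.smul_apply, map_smul] at h1
  simp only [TorusAction.scale_ext, LinearMap.smul_apply, map_smul] at h2 h3
  change _ = A.tower₁.ext B 1 t (towerδ₁ M N e) at h1
  change ∀ e, _ = A.tower₂.ext B 2 t (towerδ₂ M N e) at h2
  refine (h3 _).symm.trans ?_
  rw [← h2, ← h1]
  change _ • towerδ₃ M N (_ • towerδ₂ M N (_ • towerδ₁ M N _)) = _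
  simp only [map_smul, smul_smul]
  congr 1

/-- The Euler trace of `Ext(M, N)` in terms of that of `Ext(R ⊗ M, N)`. -/
lemma eulerTrace_eq_free (B : TorusAction w N) [FiniteDimensional ℝ (ExtR (R ⊗[ℝ] M) N 0)]
    (t : ℝˣ) : (∀ n, FiniteDimensional ℝ (ExtR M N n)) ∧
    eulerTrace A B t = (1 - ((tangentChar w 0 t)⁻¹ : ℝˣ)) * (1 - ((tangentChar w 1 t)⁻¹ : ℝˣ)) *
      (1 - ((tangentChar w 2 t)⁻¹ : ℝˣ)) * LinearMap.trace ℝ _ (A.free.ext B 0 t) := by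
  have f0 : ∀ n, FiniteDimensional ℝ (ExtR (R ⊗[ℝ] M) N n)
    | 0 => inferInstance
    | n + 1 => inferInstance
  have f1 := finite_extR_of_shortExact (exact_mkQ (koszul M 0)) (koszul_injective 0)
    (Submodule.mkQ_surjective _) (N := N)
  have f2 := finite_extR_of_shortExact (exact_mkQ (tower₁Map M 1)) tower₁Map_injective
    (Submodule.mkQ_surjective _) (N := N)
  refine ⟨finite_extR_of_shortExact exact_tower₂Aug tower₂Map_injective tower₂Aug_surjective, ?_⟩
  rw [eulerTrace_of_shortExact exact_tower₂Aug tower₂Map_injective tower₂Aug_surjective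
      (isEquivariant_tower₂Map A) (isEquivariant_tower₂Aug A),
    eulerTrace_of_shortExact (exact_mkQ _) tower₁Map_injective (Submodule.mkQ_surjective _)
      (isEquivariant_tower₁Map A 1) (A₃ := A.tower₂) (isEquivariant_mkQ _),
    eulerTrace_of_shortExact (exact_mkQ _) (koszul_injective 0) (Submodule.mkQ_surjective _)
      (isEquivariant_koszul A 0) (A₃ := A.tower₁) (isEquivariant_mkQ _)]
  -- R ⊗ M is projective, so only degree 0 contributes.
  have : eulerTrace A.free B t = LinearMap.trace ℝ _ (A.free.ext B 0 t) := by
    have h0 : ∀ n, LinearMap.trace ℝ _ (A.free.ext B (n + 1) t) = 0 := fun n => by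
      rw [Subsingleton.elim (A.free.ext B (n + 1) t) 0, map_zero]
    simp [eulerTrace, Finset.sum_range_succ, h0]
  rw [this]
  ring

end Tower

/-! ### Homomorphisms out of `R ⊗ M`, and `Ext(M, R)` -/

open TensorProduct

section FreeHom

variable {w : Fin 3 → ℤ} {M N : Type} [AddCommGroup M] [Module R M] [Module ℝ M]
  [IsScalarTower ℝ R M] [AddCommGroup N] [Module R N] [Module ℝ N] [IsScalarTower ℝ R N]

variable (M N) in
/-- `Ext⁰(R ⊗ M, N)` is the space of `ℝ`-linear maps from `M` to `N`. -/
def freeHom : (M →ₗ[ℝ] N) ≃ₗ[ℝ] ExtR (R ⊗[ℝ] M) N 0 where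
  __ := (LinearMap.liftBaseChangeEquiv (R := ℝ) (M := M) (N := N) R).toAddEquiv.trans homToExt
  map_smul' r h := by
    change homToExt (LinearMap.liftBaseChangeEquiv R (r • h)) = _
    rw [← algebraMap_smul R r h, map_smul]
    exact homToExt_smul r _

omit [Module R M] [IsScalarTower ℝ R M] in
lemma freeHom_apply (h : M →ₗ[ℝ] N) : freeHom M N h = homToExt (h.liftBaseChange R) := rfl

/-- The action of `t` on the space of `ℝ`-linear maps from `M` to `N`. -/
def conjLin (A : TorusAction w M) (B : TorusAction w N) (t : ℝˣ) :
    (M →ₗ[ℝ] N) →ₗ[ℝ] (M →ₗ[ℝ] N) where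
  toFun h := B.lin t ∘ₗ h ∘ₗ A.lin t⁻¹
  map_add' h h' := by ext; simp
  map_smul' r h := by ext; simp

lemma freeHom_conjLin (A : TorusAction w M) (B : TorusAction w N) (t : ℝˣ) (h : M →ₗ[ℝ] N) :
    freeHom M N (conjLin A B t h) = A.free.ext B 0 t (freeHom M N h) := by
  rw [freeHom_apply, freeHom_apply, TorusAction.ext_homToExt]
  congr 1
  refine TensorProduct.AlgebraTensorModule.ext fun r m => ?_
  rw [TorusAction.homAct_apply, TorusAction.free_act_tmul, LinearMap.liftBaseChange_tmul,
    LinearMap.liftBaseChange_tmul, B.act_smul, torusAct_mul_inv]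
  rfl

/-- Hom_ℝ(M, N) is M* ⊗ N, and the trace is multiplicative on tensor products; the dual factor
carries t⁻¹. -/
lemma trace_conjLin [FiniteDimensional ℝ M] [FiniteDimensional ℝ N] (A : TorusAction w M)
    (B : TorusAction w N) (t : ℝˣ) : LinearMap.trace ℝ _ (conjLin A B t) =
      LinearMap.trace ℝ M (A.lin t⁻¹) * LinearMap.trace ℝ N (B.lin t) := by
  rw [← LinearMap.trace_transpose' (A.lin t⁻¹), ← LinearMap.trace_tensorProduct']
  refine (trace_eq_of_equiv (V := Module.Dual ℝ M ⊗[ℝ] N) (V' := M →ₗ[ℝ] N)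
    (dualTensorHomEquiv ℝ M N) fun z => ?_).symm
  induction z with
  | zero => simp
  | add z z' h h' => simp only [map_add, h, h']
  | tmul f n =>
    ext m
    simp [conjLin, Module.Dual.transpose_apply]

/-- The Euler trace of `Ext(M, N)` for finite-dimensional `M` and `N`. -/
lemma eulerTrace_eq [FiniteDimensional ℝ M] [FiniteDimensional ℝ N] (A : TorusAction w M)
    (B : TorusAction w N) (t : ℝˣ) : (∀ n, FiniteDimensional ℝ (ExtR M N n)) ∧
    eulerTrace A B t = (1 - ((tangentChar w 0 t)⁻¹ : ℝˣ)) * (1 - ((tangentChar w 1 t)⁻¹ : ℝˣ)) *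
      (1 - ((tangentChar w 2 t)⁻¹ : ℝˣ)) *
        (LinearMap.trace ℝ M (A.lin t⁻¹) * LinearMap.trace ℝ N (B.lin t)) := by
  have : FiniteDimensional ℝ (ExtR (R ⊗[ℝ] M) N 0) := (freeHom M N).finiteDimensional
  rw [← trace_conjLin, trace_eq_of_equiv (freeHom M N) (freeHom_conjLin A B t)]
  exact eulerTrace_eq_free A B t

end FreeHom

/-! ### Duality: Extⁿ(M, R) for a finite-dimensional module M. -/

section Dual

variable {w : Fin 3 → ℤ} (M : Type) [AddCommGroup M] [Module R M] [Module ℝ M]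
  [IsScalarTower ℝ R M]

/-- The dual of an `R`-module over `ℝ`, with its `R`-module structure. -/
def RDual : Type := Module.Dual ℝ M

instance : AddCommGroup (RDual M) := inferInstanceAs (AddCommGroup (Module.Dual ℝ M))

instance : Module ℝ (RDual M) := inferInstanceAs (Module ℝ (Module.Dual ℝ M))

variable {M} in
/-- The dual as a space of linear maps. -/
def RDual.toLin (f : RDual M) : M →ₗ[ℝ] ℝ := f

instance : Module R (RDual M) where
  smul r f := f.toLin ∘ₗ Algebra.lsmul ℝ ℝ M r
  one_smul f := LinearMap.ext fun m => congrArg f.toLin (one_smul R m)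
  mul_smul r s f := LinearMap.ext fun m => congrArg f.toLin (by
    change (r * s) • m = s • r • m
    rw [mul_comm, mul_smul])
  smul_zero r := rfl
  zero_smul f := LinearMap.ext fun m => (congrArg f.toLin (zero_smul R m)).trans (map_zero f.toLin)
  smul_add r f g := rfl
  add_smul r s f := LinearMap.ext fun m =>
    (congrArg f.toLin (add_smul r s m)).trans (map_add f.toLin _ _)

variable {M}

lemma RDual.smul_toLin_apply (r : R) (f : RDual M) (m : M) :
    (r • f).toLin m = f.toLin (r • m) := rfl

instance : IsScalarTower ℝ R (RDual M) where
  smul_assoc a r f := LinearMap.ext fun m => by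
    change f.toLin ((a • r) • m) = a • f.toLin (r • m)
    rw [smul_assoc, map_smul]

/-- The dual action. -/
def TorusAction.dual (A : TorusAction w M) : TorusAction w (RDual M) where
  act t := (Module.Dual.transpose (A.lin t⁻¹)).toAddMonoidHom
  act_smul t r f := LinearMap.ext fun m => by
    change f.toLin (r • A.act t⁻¹ m) = f.toLin (A.act t⁻¹ (torusAct w t r • m))
    rw [A.act_inv_smul]
  act_act_inv t f := LinearMap.ext fun m => by
    change f.toLin (A.act t⁻¹⁻¹ (A.act t⁻¹ m)) = f.toLin m
    rw [inv_inv, A.act_act_inv]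

variable (w) in
/-- The action of the torus on `R`. -/
def ringAction : TorusAction w R where
  act t := (torusAct w t : R →+* R).toAddMonoidHom
  act_smul t r s := map_mul (torusAct w t) r s
  act_act_inv t r := torusAct_mul_inv w t r

variable [FiniteDimensional ℝ M]

variable (M) in
/-- `Ext⁰(R ⊗ M, R)` is `R ⊗ M*`. -/
def freeDual : R ⊗[ℝ] RDual M ≃ₗ[ℝ] ExtR (R ⊗[ℝ] M) R 0 :=
  (TensorProduct.comm ℝ R (RDual M)) ≪≫ₗ
    (dualTensorHomEquiv ℝ M R) ≪≫ₗ freeHom M R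

omit [Module R M] [IsScalarTower ℝ R M] in
lemma freeDual_tmul (r : R) (f : RDual M) :
    freeDual M (r ⊗ₜ f) = freeHom M R (f.toLin.smulRight r) := rfl

/-- The Koszul operators are self-dual: an R-linear map to R lets xᵢ ⊗ 1 pass to the coefficient,
while 1 ⊗ xᵢ becomes its transpose on M*. Regularity on R ⊗ M* therefore controls Ext(M, R). -/
lemma freeDual_koszul (i : Fin 3) (z : R ⊗[ℝ] RDual M) :
    freeDual M (koszul (RDual M) i z) = extPre (koszul M i) R 0 (freeDual M z) := by
  induction z with
  | zero => simp
  | add z z' h h' => simp only [map_add, h, h']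
  | tmul r f =>
    rw [koszul_tmul, map_sub, freeDual_tmul, freeDual_tmul, freeDual_tmul, freeHom_apply,
      freeHom_apply, freeHom_apply, extPre_homToExt, ← map_sub]
    congr 1
    refine TensorProduct.AlgebraTensorModule.ext fun s m => ?_
    simp only [LinearMap.sub_apply, LinearMap.liftBaseChange_tmul, LinearMap.comp_apply,
      koszul_tmul, map_sub, LinearMap.smulRight_apply, RDual.smul_toLin_apply, smul_eq_mul]
    congr 1
    · rw [mul_smul_comm, mul_smul_comm, mul_left_comm, mul_assoc]

lemma freeDual_act (A : TorusAction w M) (t : ℝˣ) (z : R ⊗[ℝ] RDual M) :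
    freeDual M (A.dual.free.act t z) = A.free.ext (ringAction w) 0 t (freeDual M z) := by
  induction z with
  | zero => simp
  | add z z' h h' => simp only [map_add, h, h']
  | tmul r f =>
    rw [TorusAction.free_act_tmul, freeDual_tmul, freeDual_tmul, ← freeHom_conjLin]
    congr 1
    ext m : 1
    exact (map_smul (torusAct w t) (f.toLin (A.act t⁻¹ m)) r).symm

lemma extPre_koszul_zero_injective :
    Function.Injective (extPre (koszul M 0) R 0) := by
  rw [injective_iff_map_eq_zero]
  intro x hx
  obtain ⟨z, rfl⟩ := (freeDual M).surjective x
  rw [← freeDual_koszul, LinearEquiv.map_eq_zero_iff] at hx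
  rw [koszul_injective 0 (hx.trans (map_zero _).symm), map_zero]

lemma towerδ₁_freeDual_eq_zero {z : R ⊗[ℝ] RDual M} :
    towerδ₁ M R (freeDual M z) = 0 ↔ ∃ u, z = koszul (RDual M) 0 u := by
  rw [exact_towerδ₁]
  constructor
  · rintro ⟨y, hy⟩
    obtain ⟨u, rfl⟩ := (freeDual M).surjective y
    rw [← freeDual_koszul] at hy
    exact ⟨u, (freeDual M).injective hy.symm⟩
  · rintro ⟨u, rfl⟩
    exact ⟨freeDual M u, (freeDual_koszul 0 u).symm⟩

lemma exists_towerδ₁ (x : ExtR (Tower₁ M) R 1) : ∃ z, towerδ₁ M R (freeDual M z) = x := by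
  obtain ⟨y, rfl⟩ := towerδ₁_surjective x
  obtain ⟨z, rfl⟩ := (freeDual M).surjective y
  exact ⟨z, rfl⟩

lemma extPre_towerδ₁_freeDual (i : Fin 3) (z : R ⊗[ℝ] RDual M) :
    extPre (tower₁Map M i) R 1 (towerδ₁ M R (freeDual M z)) =
      towerδ₁ M R (freeDual M (koszul (RDual M) i z)) := by
  rw [extPre_towerδ₁, freeDual_koszul]

lemma towerδ₂_freeDual_eq_zero {z : R ⊗[ℝ] RDual M} :
    towerδ₂ M R (towerδ₁ M R (freeDual M z)) = 0 ↔
      ∃ u v, z = koszul (RDual M) 0 u + koszul (RDual M) 1 v := by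
  rw [exact_towerδ₂]
  constructor
  · rintro ⟨y, hy⟩
    obtain ⟨v, rfl⟩ := exists_towerδ₁ y
    rw [extPre_towerδ₁_freeDual, eq_comm, ← sub_eq_zero, ← map_sub, ← map_sub,
      towerδ₁_freeDual_eq_zero] at hy
    obtain ⟨u, hu⟩ := hy
    exact ⟨u, v, by rw [← hu, sub_add_cancel]⟩
  · rintro ⟨u, v, rfl⟩
    refine ⟨towerδ₁ M R (freeDual M v), ?_⟩
    rw [extPre_towerδ₁_freeDual, map_add, map_add, towerδ₁_freeDual_eq_zero.2 ⟨u, rfl⟩, zero_add]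

lemma exists_towerδ₂ (x : ExtR (Tower₂ M) R 2) :
    ∃ z, towerδ₂ M R (towerδ₁ M R (freeDual M z)) = x := by
  obtain ⟨y, rfl⟩ := towerδ₂_surjective x
  obtain ⟨z, rfl⟩ := exists_towerδ₁ y
  exact ⟨z, rfl⟩

lemma extPre_towerδ₂_freeDual (z : R ⊗[ℝ] RDual M) :
    extPre (tower₂Map M) R 2 (towerδ₂ M R (towerδ₁ M R (freeDual M z))) =
      towerδ₂ M R (towerδ₁ M R (freeDual M (koszul (RDual M) 2 z))) := by
  rw [extPre_towerδ₂, extPre_towerδ₁_freeDual]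

/-- The kernel of the composite of the three connecting maps is the sum of the images of the κᵢ on R
⊗ M*, which is the kernel of the augmentation onto M*. Hence Ext³(M, R) ≅ M* as a vector space. -/
lemma towerδ₃_freeDual_eq_zero {z : R ⊗[ℝ] RDual M} :
    towerδ₃ M R (towerδ₂ M R (towerδ₁ M R (freeDual M z))) = 0 ↔
      koszulAug (RDual M) z = 0 := by
  rw [exact_towerδ₃]
  constructor
  · rintro ⟨y, hy⟩
    obtain ⟨v, rfl⟩ := exists_towerδ₂ y
    rw [extPre_towerδ₂_freeDual, eq_comm, ← sub_eq_zero, ← map_sub, ← map_sub, ← map_sub,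
      towerδ₂_freeDual_eq_zero] at hy
    obtain ⟨u, u', hu⟩ := hy
    rw [sub_eq_iff_eq_add.1 hu]
    simp [koszulAug_koszul]
  · intro h
    obtain ⟨u, rfl⟩ := exists_eq_of_koszulAug_eq_zero h
    refine ⟨towerδ₂ M R (towerδ₁ M R (freeDual M (u 2))), ?_⟩
    rw [extPre_towerδ₂_freeDual, Fin.sum_univ_three, map_add, map_add, map_add,
      towerδ₂_freeDual_eq_zero.2 ⟨u 0, u 1, rfl⟩, zero_add]

/-- If `f` acts injectively on `Extⁿ⁺¹(L₂, N)` and `Extⁿ(L₁, N)`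
vanishes, then `Extⁿ⁺¹(L₃, N)` vanishes. -/
lemma subsingleton_extR_of_injective {L₁ L₂ L₃ N : Type}
    [AddCommGroup L₁] [Module R L₁] [AddCommGroup L₂] [Module R L₂]
    [AddCommGroup L₃] [Module R L₃] [AddCommGroup N] [Module R N]
    {f : L₁ →ₗ[R] L₂} {g : L₂ →ₗ[R] L₃} (h : Function.Exact f g)
    (hf : Function.Injective f) (hg : Function.Surjective g) (n : ℕ)
    [Subsingleton (ExtR L₁ N n)] (hn : Function.Injective (extPre f N (n + 1))) :
    Subsingleton (ExtR L₃ N (n + 1)) := by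
  refine subsingleton_of_forall_eq 0 fun x => ?_
  have h1 : extPre g N (n + 1) x = 0 :=
    hn (((exact_extPre h hf hg (n + 1) _).2 ⟨x, rfl⟩).trans (map_zero _).symm)
  obtain ⟨y, rfl⟩ := (exact_extPreδ_extPre h hf hg n x).1 h1
  rw [Subsingleton.elim y 0, map_zero]

lemma subsingleton_extR_zero_of_injective {L₁ L₂ L₃ N : Type}
    [AddCommGroup L₁] [Module R L₁] [AddCommGroup L₂] [Module R L₂]
    [AddCommGroup L₃] [Module R L₃] [AddCommGroup N] [Module R N]
    {f : L₁ →ₗ[R] L₂} {g : L₂ →ₗ[R] L₃} (h : Function.Exact f g)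
    (hf : Function.Injective f) (hg : Function.Surjective g)
    (hn : Function.Injective (extPre f N 0)) : Subsingleton (ExtR L₃ N 0) := by
  refine subsingleton_of_forall_eq 0 fun x => injective_extPre_zero hg (hn ?_)
  rw [(exact_extPre h hf hg 0 _).2 ⟨x, rfl⟩, map_zero, map_zero]

instance : Subsingleton (ExtR (Tower₁ M) R 0) :=
  subsingleton_extR_zero_of_injective (exact_mkQ _) (koszul_injective 0)
    (Submodule.mkQ_surjective _) extPre_koszul_zero_injective

instance : Subsingleton (ExtR (Tower₂ M) R 0) :=
  subsingleton_extR_zero_of_injective (exact_mkQ _) tower₁Map_injective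
    (Submodule.mkQ_surjective _) (Function.injective_of_subsingleton _)

/-- Ext¹(Tower₁, R) is the cokernel of κ₀ on R ⊗ M*, where κ₁ is injective by `koszul_one_regular`.
-/
instance : Subsingleton (ExtR (Tower₂ M) R 1) := by
  refine subsingleton_extR_of_injective (exact_mkQ _) tower₁Map_injective
    (Submodule.mkQ_surjective _) 0 ?_
  rw [injective_iff_map_eq_zero]
  intro x hx
  obtain ⟨z, rfl⟩ := exists_towerδ₁ x
  rw [extPre_towerδ₁_freeDual, towerδ₁_freeDual_eq_zero] at hx
  obtain ⟨u, hu⟩ := hx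
  exact towerδ₁_freeDual_eq_zero.2 (koszul_one_regular hu)

variable (M) in
lemma subsingleton_extR_ring_zero : Subsingleton (ExtR M R 0) :=
  subsingleton_extR_zero_of_injective exact_tower₂Aug tower₂Map_injective
    tower₂Aug_surjective (Function.injective_of_subsingleton _)

variable (M) in
lemma subsingleton_extR_ring_one : Subsingleton (ExtR M R 1) := by
  have : Subsingleton (ExtR (Tower₂ M) R (0 + 1)) :=
    inferInstanceAs (Subsingleton (ExtR (Tower₂ M) R 1))
  exact subsingleton_extR_of_injective exact_tower₂Aug tower₂Map_injective
    tower₂Aug_surjective 0 (Function.injective_of_subsingleton _)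

-- Ext²(Tower₂, R) is the cokernel of κ₀ and κ₁ on R ⊗ M*, where κ₂ is injective by
-- `koszul_two_regular`.
variable (M) in
lemma subsingleton_extR_ring_two : Subsingleton (ExtR M R 2) := by
  refine subsingleton_extR_of_injective exact_tower₂Aug tower₂Map_injective
    tower₂Aug_surjective 1 ?_
  rw [injective_iff_map_eq_zero]
  intro x hx
  obtain ⟨z, rfl⟩ := exists_towerδ₂ x
  rw [extPre_towerδ₂_freeDual, towerδ₂_freeDual_eq_zero] at hx
  obtain ⟨u, v, hu⟩ := hx
  exact towerδ₂_freeDual_eq_zero.2 (koszul_two_regular hu)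

lemma exists_towerδ₃ (x : ExtR M R 3) :
    ∃ z, towerδ₃ M R (towerδ₂ M R (towerδ₁ M R (freeDual M z))) = x := by
  obtain ⟨y, rfl⟩ := towerδ₃_surjective x
  obtain ⟨z, rfl⟩ := exists_towerδ₂ y
  exact ⟨z, rfl⟩

variable (M) in
/-- The surjection `R ⊗ M* → Ext³(M, R)`. -/
def extThreeMap : R ⊗[ℝ] RDual M →ₗ[ℝ] ExtR M R 3 :=
  towerδ₃ M R ∘ₗ towerδ₂ M R ∘ₗ towerδ₁ M R ∘ₗ (freeDual M).toLinearMap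

lemma extThreeMap_surjective : Function.Surjective (extThreeMap M) := exists_towerδ₃

lemma ker_extThreeMap :
    LinearMap.ker (extThreeMap M) = LinearMap.ker ((koszulAug (RDual M)).restrictScalars ℝ) := by
  ext z
  exact towerδ₃_freeDual_eq_zero

variable (M) in
lemma finite_extR_ring_three : FiniteDimensional ℝ (ExtR M R 3) := by
  have e := (extThreeMap M).quotKerEquivOfSurjective extThreeMap_surjective
  rw [ker_extThreeMap] at e
  have e' := ((koszulAug (RDual M)).restrictScalars ℝ).quotKerEquivOfSurjective
    koszulAug_surjective
  have : FiniteDimensional ℝ (RDual M) := inferInstanceAs (FiniteDimensional ℝ (Module.Dual ℝ M))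
  exact (e'.symm ≪≫ₗ e).finiteDimensional

/-- The trace on `Ext³(M, R)`. -/
lemma trace_ext_ring_three (A : TorusAction w M) (t : ℝˣ) :
    LinearMap.trace ℝ _ (A.ext (ringAction w) 3 t) =
      ((tangentDet w t)⁻¹ : ℝˣ) * LinearMap.trace ℝ M (A.lin t⁻¹) := by
  -- Multiplying by s₁s₂s₃ cancels the twist of the connecting maps, so that the action matches the
  -- dual action on M*.
  have h1 : LinearMap.trace ℝ _ ((tangentDet w t : ℝ) • A.ext (ringAction w) 3 t) =
      LinearMap.trace ℝ (RDual M) (A.dual.lin t) := by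
    refine trace_eq_of_surjective_of_ker_eq extThreeMap_surjective
      (g := (koszulAug (RDual M)).restrictScalars ℝ) koszulAug_surjective ker_extThreeMap
      (T := A.dual.free.lin t) (fun z => ?_) (fun z => isEquivariant_koszulAug A.dual t z)
    have h2 := towerδ_ext A (ringAction w) t (freeDual M z)
    rw [← freeDual_act] at h2
    refine Eq.symm ((congrArg ((tangentDet w t : ℝ) • ·) h2).trans ?_)
    rw [smul_smul, Units.mul_inv, one_smul]
    rfl
  have h2 : LinearMap.trace ℝ (RDual M) (A.dual.lin t) = LinearMap.trace ℝ M (A.lin t⁻¹) :=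
    LinearMap.trace_transpose' (A.lin t⁻¹)
  rw [← h2, ← h1, map_smul, smul_eq_mul, ← mul_assoc, Units.inv_mul, one_mul]

end Dual

/-! ### The torus actions on `R`, `I` and `R / I` -/

section IdealWeights

variable {w : Fin 3 → ℤ} {I : Ideal R} (hI : IsTorusStable w I)

/-- The weight of a monomial. -/
def monomialWeight (w : Fin 3 → ℤ) (m : Fin 3 →₀ ℕ) : ℤ := ∑ j, w j * m j

lemma torusAct_monomial (t : ℝˣ) (m : Fin 3 →₀ ℕ) :
    torusAct w t (monomial m 1) = ((t : ℝ) ^ monomialWeight w m) • monomial m (1 : ℝ) := by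
  rw [torusAct, aeval_monomial, map_one, one_mul, monomial_eq, smul_eq_C_mul, C_1, one_mul,
    Finsupp.prod_fintype _ _ (by simp), Finsupp.prod_fintype _ _ (by simp), monomialWeight]
  simp only [Fin.prod_univ_three, Fin.sum_univ_three, zpow_add₀ t.ne_zero, zpow_mul, zpow_natCast,
    mul_pow, C_mul, C_pow]
  ring

lemma isSpannedByWeights_ring : IsSpannedByWeights (ringAction w).lin := by
  refine top_le_iff.1 ?_
  rw [← (basisMonomials (Fin 3) ℝ).span_eq, Submodule.span_le]
  rintro _ ⟨m, rfl⟩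
  refine Submodule.mem_iSup_of_mem (monomialWeight w m) ((mem_weightSpace _ _ _).2 fun t => ?_)
  rw [coe_basisMonomials]
  exact torusAct_monomial t m

/-- The action of the torus on `R / I`. -/
def quotAction : TorusAction w (R ⧸ I) where
  act t := (quotAct hI t).toAddMonoidHom
  act_smul t r l := by
    obtain ⟨l, rfl⟩ := Ideal.Quotient.mk_surjective l
    exact congrArg (Ideal.Quotient.mk I) (map_mul (torusAct w t) r l)
  act_act_inv t l := by
    obtain ⟨l, rfl⟩ := Ideal.Quotient.mk_surjective l
    exact congrArg (Ideal.Quotient.mk I) (torusAct_mul_inv w t l)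

lemma quotAction_lin (t : ℝˣ) : (quotAction hI).lin t = quotAct hI t := rfl

lemma isEquivariant_subtype : (idealAction hI).IsEquivariant (ringAction w) I.subtype :=
  fun _ _ => rfl

lemma isEquivariant_mk : (ringAction w).IsEquivariant (quotAction hI) I.mkQ :=
  fun _ _ => rfl

lemma exact_subtype_mkQ (I : Ideal R) : Function.Exact I.subtype I.mkQ :=
  LinearMap.exact_subtype_mkQ I

lemma isSpannedByWeights_quot : IsSpannedByWeights (quotAct hI) :=
  isSpannedByWeights_ring.of_surjective (f := I.mkQ.restrictScalars ℝ)
    (Submodule.mkQ_surjective I) 0 fun t v => by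
      rw [zpow_zero, one_smul]; rfl

lemma isSpannedByWeights_ideal : IsSpannedByWeights (idealAction hI).lin :=
  isSpannedByWeights_ring.of_injective (f := I.subtype.restrictScalars ℝ)
    Subtype.val_injective fun _ _ => rfl

/-- Maps from a finite set of elements with weights to a space spanned by weights. -/
lemma IsSpannedByWeights.pi {V ι : Type} [AddCommGroup V] [Module ℝ V] [Finite ι]
    {ρ : ℝˣ → V →ₗ[ℝ] V} (h : IsSpannedByWeights ρ) (d : ι → ℤ)
    (ρ' : ℝˣ → (ι → V) →ₗ[ℝ] (ι → V))
    (hρ : ∀ t v i, ρ' t v i = ((t : ℝ) ^ d i) • ρ t (v i)) : IsSpannedByWeights ρ' := by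
  classical
  have := Fintype.ofFinite ι
  refine top_le_iff.1 fun v _ => ?_
  rw [← Finset.univ_sum_single v]
  refine Submodule.sum_mem _ fun i _ => ?_
  have hv : v i ∈ ⨆ m, weightSpace ρ m := by rw [show _ = _ from h]; trivial
  generalize v i = u at hv
  induction hv using Submodule.iSup_induction' with
  | mem m u hu =>
    refine Submodule.mem_iSup_of_mem (d i + m) ((mem_weightSpace _ _ _).2 fun t => ?_)
    ext j
    rw [hρ, Pi.smul_apply]
    by_cases hij : j = i
    · subst hij
      rw [Pi.single_eq_same, (mem_weightSpace ρ _ _).1 hu t, smul_smul, zpow_add₀ t.ne_zero]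
    · simp [hij]
  | zero => simp
  | add u u' _ _ h h' =>
    rw [Pi.single_add]
    exact Submodule.add_mem _ h h'

/-- An `R`-module that is spanned by weights and finitely generated is generated by finitely many
weight vectors. -/
lemma exists_weight_generators {L : Type} [AddCommGroup L] [Module R L] [Module ℝ L]
    [IsScalarTower ℝ R L] [Module.Finite R L] {A : TorusAction w L}
    (h : IsSpannedByWeights A.lin) : ∃ (n : ℕ) (g : Fin n → L) (d : Fin n → ℤ),
      (∀ i, g i ∈ weightSpace A.lin (d i)) ∧ Submodule.span R (Set.range g) = ⊤ := by
  have hs : Submodule.span R (⋃ m, (weightSpace A.lin m : Set L)) = ⊤ := by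
    refine top_le_iff.1 fun l _ => ?_
    have : l ∈ Submodule.span ℝ (⋃ m, (weightSpace A.lin m : Set L)) := by
      rw [← Submodule.iSup_eq_span, show _ = _ from h]; trivial
    exact Submodule.span_le_restrictScalars ℝ R _ this
  -- Finite generation allows the finite generating set to be chosen among the weight vectors.
  obtain ⟨T, hT, hT'⟩ := (Submodule.fg_span_iff_fg_span_finset_subset _).1
    (hs ▸ Module.Finite.fg_top)
  have hT'' : ∀ x : T, ∃ m, (x : L) ∈ weightSpace A.lin m := fun x => by
    simpa using hT x.2
  choose d hd using hT''
  refine ⟨_, fun i => (T.equivFin.symm i : L), fun i => d (T.equivFin.symm i), fun i => hd _, ?_⟩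
  rw [← hs, hT']
  congr 1
  ext x
  constructor
  · rintro ⟨i, rfl⟩
    exact (T.equivFin.symm i).2
  · intro hx
    exact ⟨T.equivFin ⟨x, hx⟩, by simp⟩

/-- `Hom(L, N)` is spanned by weights if `L` is finitely generated and `L` and `N` are spanned by
weights. -/
lemma isSpannedByWeights_ext_zero {L N : Type} [AddCommGroup L] [Module R L] [Module ℝ L]
    [IsScalarTower ℝ R L] [Module.Finite R L] [AddCommGroup N] [Module R N] [Module ℝ N]
    [IsScalarTower ℝ R N] {A : TorusAction w L} {B : TorusAction w N}
    (hA : IsSpannedByWeights A.lin) (hB : IsSpannedByWeights B.lin) :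
    IsSpannedByWeights (A.ext B 0) := by
  obtain ⟨n, g, d, hg, hs⟩ := exists_weight_generators hA
  -- Evaluation at the weight generators embeds Hom(L, N) in Nⁿ; it is equivariant once the i-th
  -- copy of N is twisted by the weight `-d i`.
  let f : ExtR L N 0 →ₗ[ℝ] (Fin n → N) :=
    { toFun := fun e i => homToExt.symm e (g i)
      map_add' := fun e e' => by
        ext i
        rw [map_add]
        rfl
      map_smul' := fun r e => by
        obtain ⟨h, rfl⟩ := homToExt.surjective e
        ext i
        rw [← homToExt_smul, AddEquiv.symm_apply_apply, AddEquiv.symm_apply_apply]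
        exact algebraMap_smul R r (h (g i)) }
  have hf : ∀ h i, f (homToExt h) i = h (g i) := fun h i =>
    congrArg (fun h => h (g i)) (AddEquiv.symm_apply_apply homToExt h)
  refine (hB.pi (fun i => - d i)
    (fun t => LinearMap.pi fun i => ((t : ℝ) ^ (-d i)) • B.lin t ∘ₗ LinearMap.proj i)
    (fun t v i => rfl)).of_injective (f := f) ?_ ?_
  · intro e e' he
    obtain ⟨h, rfl⟩ := homToExt.surjective e
    obtain ⟨h', rfl⟩ := homToExt.surjective e'
    congr 1
    refine LinearMap.ext_on_range hs fun i => ?_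
    rw [← hf, he, hf]
  · intro t e
    obtain ⟨h, rfl⟩ := homToExt.surjective e
    ext i
    rw [TorusAction.ext_homToExt, hf, TorusAction.homAct_apply]
    have h1 : A.act t⁻¹ (g i) = ((t : ℝ) ^ (-d i)) • g i := by
      have := (mem_weightSpace _ _ _).1 (hg i) t⁻¹
      rw [Units.val_inv_eq_inv_val, inv_zpow, ← zpow_neg] at this
      exact this
    have h2 : h (((t : ℝ) ^ (-d i)) • g i) = ((t : ℝ) ^ (-d i)) • h (g i) :=
      LinearMap.map_smul_of_tower h _ _
    rw [h1, h2]
    change B.lin t _ = ((t : ℝ) ^ (-d i)) • B.lin t (f (homToExt h) i)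
    rw [map_smul, hf]

end IdealWeights

/-! ### The torus action on `Ext(I, I)` -/

section ExtIdeal

variable {w : Fin 3 → ℤ} {I : Ideal R} (hI : IsTorusStable w I)

/-- `Ext⁰(R / I, R / I)` is `R / I`. -/
def quotEnd (I : Ideal R) : (R ⧸ I) →ₗ[ℝ] ExtR (R ⧸ I) (R ⧸ I) 0 where
  toFun m := homToExt (Algebra.lmul R (R ⧸ I) m)
  map_add' m m' := by rw [map_add, map_add]
  map_smul' r m := by
    rw [← algebraMap_smul R r m, map_smul]
    exact homToExt_smul r _

lemma quotEnd_injective : Function.Injective (quotEnd I) := fun m m' h => by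
  have h1 := LinearMap.congr_fun (homToExt.injective h) (1 : R ⧸ I)
  simpa using h1

lemma quotEnd_surjective : Function.Surjective (quotEnd I) := fun e => by
  obtain ⟨h, rfl⟩ := homToExt.surjective e
  refine ⟨h 1, congrArg homToExt (LinearMap.ext fun x => ?_)⟩
  obtain ⟨r, rfl⟩ := Ideal.Quotient.mk_surjective x
  have h1 : (Ideal.Quotient.mk I r) = r • (1 : R ⧸ I) := by
    change _ = Ideal.Quotient.mk I (r * 1)
    rw [mul_one]
  rw [h1, map_smul, map_smul]
  simp

lemma quotEnd_act (t : ℝˣ) (m : R ⧸ I) :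
    quotEnd I (quotAct hI t m) = (quotAction hI).ext (quotAction hI) 0 t (quotEnd I m) := by
  refine Eq.trans ?_ (TorusAction.ext_homToExt _ _ _ _).symm
  refine congrArg homToExt (LinearMap.ext fun x => ?_)
  rw [TorusAction.homAct_apply]
  obtain ⟨r, rfl⟩ := Ideal.Quotient.mk_surjective m
  obtain ⟨s, rfl⟩ := Ideal.Quotient.mk_surjective x
  refine congrArg (Ideal.Quotient.mk I) (?_ : _ = torusAct w t (r * torusAct w t⁻¹ s))
  rw [map_mul, torusAct_mul_inv]
  rfl

lemma trace_ext_quot_zero (t : ℝˣ) :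
    LinearMap.trace ℝ _ ((quotAction hI).ext (quotAction hI) 0 t) =
      LinearMap.trace ℝ _ (quotAct hI t) :=
  (trace_eq_of_equiv (LinearEquiv.ofBijective (quotEnd I) ⟨quotEnd_injective, quotEnd_surjective⟩)
    (quotEnd_act hI t)).symm

variable (I) in
/-- The connecting map `Extⁿ(I, N) → Extⁿ⁺¹(R / I, N)`. -/
def quotδ (N : Type) [AddCommGroup N] [Module R N] (n : ℕ) :
    ExtR I N n →ₗ[ℝ] ExtR (R ⧸ I) N (n + 1) :=
  extPreδ (exact_subtype_mkQ I) Subtype.val_injective (Submodule.mkQ_surjective I) N n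

/-- Dimension shifting: the kernel comes from Extⁿ⁺¹(R, N) = 0. In degree 0 it would be the image of
Hom(R, N), hence the index `n + 1`. -/
lemma quotδ_injective {N : Type} [AddCommGroup N] [Module R N] (n : ℕ) :
    Function.Injective (quotδ I N (n + 1)) := by
  rw [injective_iff_map_eq_zero]
  intro x hx
  have : Subsingleton (ExtR R N (n + 1)) := subsingleton_extR_of_projective n
  obtain ⟨y, rfl⟩ := (exact_extPre_extPreδ (exact_subtype_mkQ I) Subtype.val_injective
    (Submodule.mkQ_surjective I) (n + 1) x).1 hx
  rw [Subsingleton.elim y 0, map_zero]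

lemma quotδ_surjective {N : Type} [AddCommGroup N] [Module R N] (n : ℕ) :
    Function.Surjective (quotδ I N n) := fun x => by
  have : Subsingleton (ExtR R N (n + 1)) := subsingleton_extR_of_projective n
  exact (exact_extPreδ_extPre (exact_subtype_mkQ I) Subtype.val_injective
    (Submodule.mkQ_surjective I) n x).1 (Subsingleton.elim _ _)

lemma quotδ_ext {N : Type} [AddCommGroup N] [Module R N] (B : TorusAction w N) (n : ℕ) (t : ℝˣ)
    (e : ExtR I N n) : quotδ I N n ((idealAction hI).ext B n t e) =
      (quotAction hI).ext B (n + 1) t (quotδ I N n e) :=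
  extPreδ_ext _ _ _ (isEquivariant_subtype hI) (isEquivariant_mk hI) B n t e

/-- By definition `extAct` is the action on Ext obtained from `idealAction` in both arguments, so
the equivariant dimension shift applies to it directly. -/
lemma trace_extAct (n : ℕ) (t : ℝˣ) : LinearMap.trace ℝ _ (extAct hI (n + 1) t) =
    LinearMap.trace ℝ _ ((quotAction hI).ext (idealAction hI) (n + 2) t) :=
  trace_eq_of_equiv (LinearEquiv.ofBijective (quotδ I I (n + 1))
    ⟨quotδ_injective n, quotδ_surjective (n + 1)⟩) (quotδ_ext hI (idealAction hI) (n + 1) t)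

variable [FiniteDimensional ℝ (R ⧸ I)]

variable (I) in
lemma finite_extR_quot_ring : ∀ n, FiniteDimensional ℝ (ExtR (R ⧸ I) R n)
  | 0 => have := subsingleton_extR_ring_zero (R ⧸ I); inferInstance
  | 1 => have := subsingleton_extR_ring_one (R ⧸ I); inferInstance
  | 2 => have := subsingleton_extR_ring_two (R ⧸ I); inferInstance
  | 3 => finite_extR_ring_three (R ⧸ I)
  | n + 4 => have := subsingleton_extR_of_three_lt (M := R ⧸ I) (N := R) n; inferInstance

-- In positive degree the space lies between Extⁿ(R/I, R/I) and Extⁿ⁺¹(R/I, R) in the long exact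
-- sequence. This matters because I itself is infinite-dimensional.
include hI in
lemma finite_extR_quot_ideal (n : ℕ) : FiniteDimensional ℝ (ExtR (R ⧸ I) I n) := by
  cases n with
  | zero =>
    have := finite_extR_quot_ring I 0
    exact FiniteDimensional.of_injective _
      (injective_extPost_zero (N := R ⧸ I) (f := I.subtype) Subtype.val_injective)
  | succ n =>
    -- The value t = 1 is arbitrary: only finiteness is taken from this lemma.
    obtain ⟨h, -⟩ := eulerTrace_eq (quotAction hI) (quotAction hI) 1
    have := finite_extR_quot_ring I (n + 1)
    have := h n
    exact finiteDimensional_of_exact (exact_extPostδ_extPost (N := R ⧸ I) (exact_subtype_mkQ I)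
      Subtype.val_injective (Submodule.mkQ_surjective I) n)

include hI in
lemma finite_extR_ideal (n : ℕ) : FiniteDimensional ℝ (ExtR I I (n + 1)) := by
  have := finite_extR_quot_ideal hI (n + 2)
  exact FiniteDimensional.of_injective _ (quotδ_injective (I := I) (N := I) n)

/-- The difference of the traces on `Ext¹(I, I)` and on `Ext²(I, I)`. -/
lemma trace_extAct_sub (t : ℝˣ) : LinearMap.trace ℝ _ (extAct hI 1 t) -
    LinearMap.trace ℝ _ (extAct hI 2 t) = LinearMap.trace ℝ _ (quotAct hI t) -
      ((tangentDet w t)⁻¹ : ℝˣ) * LinearMap.trace ℝ _ (quotAct hI t⁻¹) -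
      (1 - ((tangentChar w 0 t)⁻¹ : ℝˣ)) * (1 - ((tangentChar w 1 t)⁻¹ : ℝˣ)) *
      (1 - ((tangentChar w 2 t)⁻¹ : ℝˣ)) *
        (LinearMap.trace ℝ _ (quotAct hI t⁻¹) * LinearMap.trace ℝ _ (quotAct hI t)) := by
  have fB := finite_extR_quot_ring I
  have fA := finite_extR_quot_ideal hI
  obtain ⟨fC, hχ⟩ := eulerTrace_eq (quotAction hI) (quotAction hI) t
  have s0 := subsingleton_extR_ring_zero (R ⧸ I)
  have s1 := subsingleton_extR_ring_one (R ⧸ I)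
  have s2 := subsingleton_extR_ring_two (R ⧸ I)
  have s3 : Subsingleton (ExtR (R ⧸ I) I (3 + 1)) := subsingleton_extR_of_three_lt 0
  have hf : Function.Injective I.subtype := Subtype.val_injective
  have hg := Submodule.mkQ_surjective I
  have h := exact_subtype_mkQ I
  have ef := isEquivariant_subtype hI
  have eg := isEquivariant_mk hI
  have key := sum_trace_of_longExact (k := ℝ) (fun n => extPost (R ⧸ I) I.subtype n)
    (fun n => extPost (R ⧸ I) I.mkQ n)
    (fun n => extPostδ h hf hg (R ⧸ I) n) (fun n => (quotAction hI).ext (idealAction hI) n t)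
    (fun n => (quotAction hI).ext (ringAction w) n t)
    (fun n => (quotAction hI).ext (quotAction hI) n t) (fun n => ef.extPost _ n t)
    (fun n => eg.extPost _ n t)
    (fun n => extPostδ_ext h hf hg ef eg _ n t) (injective_extPost_zero hf)
    (fun n => exact_extPost h hf hg n) (fun n => exact_extPost_extPostδ h hf hg n)
    (fun n => exact_extPostδ_extPost h hf hg n) 3 (by
      ext x
      exact Subsingleton.elim _ _)
  -- Hom(R/I, I) embeds in Hom(R/I, R) = 0.
  have hA0 : Subsingleton (ExtR (R ⧸ I) I 0) :=
    (injective_extPost_zero (N := R ⧸ I) (f := I.subtype) hf).subsingleton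
  have b0 : LinearMap.trace ℝ _ ((quotAction hI).ext (ringAction w) 0 t) = 0 := by
    rw [Subsingleton.elim ((quotAction hI).ext (ringAction w) 0 t) 0, map_zero]
  have b1 : LinearMap.trace ℝ _ ((quotAction hI).ext (ringAction w) 1 t) = 0 := by
    rw [Subsingleton.elim ((quotAction hI).ext (ringAction w) 1 t) 0, map_zero]
  have b2 : LinearMap.trace ℝ _ ((quotAction hI).ext (ringAction w) 2 t) = 0 := by
    rw [Subsingleton.elim ((quotAction hI).ext (ringAction w) 2 t) 0, map_zero]
  have a0 : LinearMap.trace ℝ _ ((quotAction hI).ext (idealAction hI) 0 t) = 0 := by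
    rw [Subsingleton.elim ((quotAction hI).ext (idealAction hI) 0 t) 0, map_zero]
  -- Since Hom(R/I, R) and Ext¹(R/I, R) vanish, the connecting map identifies Hom(R/I, R/I) ≅ R/I
  -- with Ext¹(R/I, I).
  have a1 : LinearMap.trace ℝ _ ((quotAction hI).ext (idealAction hI) 1 t) =
      LinearMap.trace ℝ _ (quotAct hI t) := by
    rw [← trace_ext_quot_zero]
    refine (trace_eq_of_equiv (LinearEquiv.ofBijective (extPostδ h hf hg (R ⧸ I) 0) ⟨?_, ?_⟩)
      (extPostδ_ext h hf hg ef eg (quotAction hI) 0 t)).symm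
    · rw [injective_iff_map_eq_zero]
      intro x hx
      obtain ⟨y, rfl⟩ := (exact_extPost_extPostδ h hf hg 0 x).1 hx
      rw [Subsingleton.elim y 0, map_zero]
    · exact fun x => (exact_extPostδ_extPost h hf hg 0 x).1 (Subsingleton.elim _ _)
  have b3 := trace_ext_ring_three (quotAction hI) t
  rw [trace_extAct hI 0, trace_extAct hI 1]
  unfold eulerTrace at hχ
  simp only [Finset.sum_range_succ, Finset.sum_range_zero, quotAction_lin] at key hχ b3
  rw [b0, b1, b2, b3, a0, a1] at key
  linear_combination key - hχ

lemma isFiniteTorusRep_quot : IsFiniteTorusRep (quotAct hI) :=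
  (isSpannedByWeights_quot hI).isFiniteTorusRep

/-- Ext¹(I, R) embeds in Ext²(R/I, R) = 0, so Ext¹(I, I) is an equivariant quotient of Hom(I, R/I),
whose weights come from finitely many weight generators of I. -/
lemma isFiniteTorusRep_extAct_one : IsFiniteTorusRep (extAct hI 1) := by
  have := finite_extR_ideal hI 0
  have h0 : IsSpannedByWeights ((idealAction hI).ext (quotAction hI) 0) :=
    isSpannedByWeights_ext_zero (isSpannedByWeights_ideal hI) (isSpannedByWeights_quot hI)
  refine (h0.of_surjective (f := extPostδ (exact_subtype_mkQ I) Subtype.val_injective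
    (Submodule.mkQ_surjective I) I 0) ?_ 0 fun t v => ?_).isFiniteTorusRep
  · intro x
    have := subsingleton_extR_ring_two (R ⧸ I)
    have : Subsingleton (ExtR I R 1) := (quotδ_injective (I := I) (N := R) 0).subsingleton
    exact (exact_extPostδ_extPost (exact_subtype_mkQ I) Subtype.val_injective
      (Submodule.mkQ_surjective I) 0 x).1 (Subsingleton.elim _ _)
  · rw [zpow_zero, one_smul]
    exact extPostδ_ext _ _ _ (isEquivariant_subtype hI) (isEquivariant_mk hI) _ 0 t v

/-- Ext²(I, I) embeds in Ext³(R/I, I), which the tower of connecting maps presents as a quotient of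
Hom_ℝ(R/I, I) with weights shifted by w 0 + w 1 + w 2. -/
lemma isFiniteTorusRep_extAct_two : IsFiniteTorusRep (extAct hI 2) := by
  have := finite_extR_ideal hI 1
  have h0 : IsSpannedByWeights (conjLin (quotAction hI) (idealAction hI)) :=
    (isSpannedByWeights_quot hI).linearMap (isSpannedByWeights_ideal hI) _ fun _ _ _ => rfl
  have h1 : IsSpannedByWeights ((quotAction hI).ext (idealAction hI) 3) := by
    refine h0.of_surjective (f := towerδ₃ _ _ ∘ₗ towerδ₂ _ _ ∘ₗ towerδ₁ _ _ ∘ₗ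
      (freeHom (R ⧸ I) I).toLinearMap) ?_ (w 0 + w 1 + w 2) fun t v => ?_
    · exact towerδ₃_surjective.comp (towerδ₂_surjective.comp
        (towerδ₁_surjective.comp (freeHom (R ⧸ I) I).surjective))
    · have h2 := towerδ_ext (quotAction hI) (idealAction hI) t (freeHom (R ⧸ I) I v)
      rw [← freeHom_conjLin] at h2
      have h3 : (t : ℝ) ^ (w 0 + w 1 + w 2) = (tangentDet w t : ℝˣ) := by
        simp [tangentDet, tangentChar_apply, zpow_add₀ t.ne_zero]
      refine Eq.symm ((congrArg (((t : ℝ) ^ (w 0 + w 1 + w 2)) • ·) h2).trans ?_)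
      rw [h3, smul_smul, Units.mul_inv, one_smul]
      rfl
  exact (h1.of_injective (quotδ_injective (I := I) (N := I) 1)
    (quotδ_ext hI (idealAction hI) 2)).isFiniteTorusRep

end ExtIdeal

/-! ### The trace formula -/

section TraceFormula

variable {w : Fin 3 → ℤ} {I : Ideal R} (hI : IsTorusStable w I) [FiniteDimensional ℝ (R ⧸ I)]

/-- At a real t, inverting T means evaluating at t⁻¹, so the identity becomes `trace_extAct_sub`
with denominators cleared. -/
lemma tr_extAct_sub {s : Fin 3 → ℤ[T;T⁻¹]} {Q : ℤ[T;T⁻¹]}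
    (hs : ∀ j, s j = LaurentPolynomial.T (w j)) (hQ : Q = tr (quotAct hI)) :
    tr (extAct hI 1) - tr (extAct hI 2) =
      (s 0 * s 1 * s 2 * Q - LaurentPolynomial.invert Q +
        Q * LaurentPolynomial.invert Q * ((1 - s 0) * (1 - s 1) * (1 - s 2))) *
          LaurentPolynomial.invert (s 0 * s 1 * s 2) := by
  refine ext_of_evalLaurent fun t => ?_
  have hs' : ∀ j, evalLaurent t (s j) = (tangentChar w j t : ℝˣ) := fun j => by
    rw [hs, evalLaurent_T, tangentChar_apply]
  have hs'' : ∀ j, evalLaurent t⁻¹ (s j) = ((tangentChar w j t)⁻¹ : ℝ) := fun j => by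
    rw [hs, evalLaurent_T, tangentChar_apply, Units.val_inv_eq_inv_val, inv_zpow]
  simp only [map_sub, map_mul, map_add, map_one, evalLaurent_invert, hs', hs'', hQ,
    (isFiniteTorusRep_extAct_one hI).evalLaurent_tr, (isFiniteTorusRep_extAct_two hI).evalLaurent_tr,
    (isFiniteTorusRep_quot hI).evalLaurent_tr]
  rw [trace_extAct_sub]
  simp only [tangentDet, MonoidHom.mul_apply, mul_inv, Units.val_mul, Units.val_inv_eq_inv_val]
  have h0 := (tangentChar w 0 t).ne_zero
  have h1 := (tangentChar w 1 t).ne_zero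
  have h2 := (tangentChar w 2 t).ne_zero
  field_simp
  ring

-- A polynomial lies in a monomial ideal exactly when each of its monomials does; this makes the
-- standard monomials independent modulo I.
omit [FiniteDimensional ℝ (R ⧸ I)] in
lemma IsMonomial.mem_iff (h : IsMonomial I) (f : R) :
    f ∈ I ↔ ∀ m ∈ f.support, m ∉ stdMonomials I := by
  obtain ⟨S, rfl⟩ := h
  have h1 : ∀ m : Fin 3 →₀ ℕ, m ∉ stdMonomials (Ideal.span ((fun m => monomial m (1 : ℝ)) '' S)) ↔
      ∃ s ∈ S, s ≤ m := fun m => by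
    simp [stdMonomials, mem_ideal_span_monomial_image, support_monomial]
  simp only [h1, mem_ideal_span_monomial_image]

/-- The standard monomials as elements of `R / I`. -/
def stdMonomial (I : Ideal R) (m : stdMonomials I) : R ⧸ I := Ideal.Quotient.mk I (monomial m.1 1)

omit [FiniteDimensional ℝ (R ⧸ I)] in
lemma IsMonomial.linearIndependent (h : IsMonomial I) : LinearIndependent ℝ (stdMonomial I) := by
  have h1 : LinearIndependent ℝ (fun m : stdMonomials I => monomial (R := ℝ) m.1 (1 : ℝ)) := by
    have := (basisMonomials (Fin 3) ℝ).linearIndependent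
    rw [coe_basisMonomials] at this
    exact this.comp _ Subtype.val_injective
  refine h1.map (f := (I.mkQ.restrictScalars ℝ)) ?_
  rw [Submodule.disjoint_def]
  intro f hf hf'
  have hfI : f ∈ I := by
    rw [LinearMap.mem_ker] at hf'
    exact (Submodule.Quotient.mk_eq_zero I).1 hf'
  by_contra hne
  obtain ⟨m, hm⟩ := Finset.nonempty_of_ne_empty (mt support_eq_empty.1 hne)
  refine (h.mem_iff f).1 hfI m hm ?_
  have h2 : f ∈ restrictSupport ℝ (stdMonomials I) := by
    rw [restrictSupport_eq_span, Set.image_eq_range]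
    exact hf
  exact h2 hm

omit [FiniteDimensional ℝ (R ⧸ I)] in
lemma span_stdMonomial (I : Ideal R) : ⊤ ≤ Submodule.span ℝ (Set.range (stdMonomial I)) := by
  intro x _
  obtain ⟨f, rfl⟩ := Ideal.Quotient.mk_surjective x
  induction f using MvPolynomial.induction_on' with
  | monomial m a =>
    have h1 : Ideal.Quotient.mk I (monomial m a) = a • Ideal.Quotient.mk I (monomial m 1) := by
      rw [← mul_one a, ← smul_eq_mul, ← smul_monomial, smul_eq_mul, mul_one]
      rfl
    rw [h1]
    refine Submodule.smul_mem _ _ ?_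
    by_cases hm : m ∈ stdMonomials I
    · exact Submodule.subset_span ⟨⟨m, hm⟩, rfl⟩
    · rw [Ideal.Quotient.eq_zero_iff_mem.2 (not_not.1 hm)]
      exact Submodule.zero_mem _
  | add f g hf hg =>
    rw [map_add]
    exact Submodule.add_mem _ (hf trivial) (hg trivial)

lemma IsMonomial.finite_stdMonomials (h : IsMonomial I) : (stdMonomials I).Finite :=
  have := h.linearIndependent.finite
  Set.toFinite _

/-- The standard monomials form a basis of R/I in which the torus acts diagonally, so the trace is
the sum of their characters. -/
lemma IsMonomial.tr_quotAct (h : IsMonomial I) {s : Fin 3 → ℤ[T;T⁻¹]}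
    (hs : ∀ j, s j = LaurentPolynomial.T (w j)) :
    tr (quotAct hI) = ∑ᶠ m ∈ stdMonomials I, s 0 ^ m 0 * s 1 ^ m 1 * s 2 ^ m 2 := by
  classical
  have hfin := h.finite_stdMonomials
  have := hfin.fintype
  let b := Module.Basis.mk h.linearIndependent (span_stdMonomial I)
  refine ext_of_evalLaurent fun t => ?_
  rw [(isFiniteTorusRep_quot hI).evalLaurent_tr, LinearMap.trace_eq_matrix_trace ℝ b,
    finsum_mem_eq_finite_toFinset_sum _ hfin, map_sum, Matrix.trace]
  have h1 : ∀ m, quotAct hI t (b m) = ((t : ℝ) ^ monomialWeight w m.1) • b m := fun m => by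
    rw [Module.Basis.mk_apply]
    exact congrArg (Ideal.Quotient.mk I) (torusAct_monomial t m.1)
  refine Eq.trans (Finset.sum_congr rfl fun m _ => (?_ : _ =
    (fun m : Fin 3 →₀ ℕ => (t : ℝ) ^ monomialWeight w m) m.1)) ?_
  · rw [Matrix.diag_apply, LinearMap.toMatrix_apply, h1, map_smul, Finsupp.smul_apply,
      Module.Basis.repr_self, Finsupp.single_eq_same, smul_eq_mul, mul_one]
  · refine (Finset.sum_subtype hfin.toFinset (fun _ => hfin.mem_toFinset)
      fun m => (t : ℝ) ^ monomialWeight w m).symm.trans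
      (Finset.sum_congr rfl fun m _ => ?_)
    simp only [map_mul, map_pow, hs, evalLaurent_T, monomialWeight, Fin.sum_univ_three,
      zpow_add₀ t.ne_zero, zpow_mul, zpow_natCast]

end TraceFormula

/-! ### Finiteness of the chart quotients -/

lemma X_mem_grS (i : Fin 4) : (X i : MvPolynomial (Fin 4) ℝ) ∈ grS 1 := isHomogeneous_X ℝ i

lemma algebraMap_grS_zero_surjective : Function.Surjective (algebraMap ℝ (grS 0)) := by
  rintro ⟨f, hf⟩
  have hf' : f.IsHomogeneous 0 := hf
  refine ⟨coeff 0 f, Subtype.ext ?_⟩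
  exact (totalDegree_eq_zero_iff_eq_C.1 (Nat.le_zero.1 hf'.totalDegree_le)).symm

/-- The constants as sections on the chart `U_i`. -/
def chartConst (i : Fin 4) : grS 0 →+* Γ(PThree, (chart i).1) :=
  (Proj.awayToSection grS (X i)).hom.comp
    (HomogeneousLocalization.fromZeroRingHom grS (Submonoid.powers (X i)))

/-- This expresses the structure morphism on a chart as a ring homomorphism, so that finiteness
becomes a statement about rings. -/
lemma fromSpec_toSpecZero {σ A : Type} [CommRing A] [SetLike σ A] [AddSubgroupClass σ A]
    (𝒜 : ℕ → σ) [GradedRing 𝒜] {f : A} {m : ℕ} (hf : f ∈ 𝒜 m) (hm : 0 < m) :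
    (Proj.isAffineOpen_basicOpen 𝒜 f hf hm).fromSpec ≫ Proj.toSpecZero 𝒜 =
      Spec.map (CommRingCat.ofHom
        (HomogeneousLocalization.fromZeroRingHom 𝒜 (Submonoid.powers f)) ≫
          Proj.awayToSection 𝒜 f) := by
  have h : (Proj.isAffineOpen_basicOpen 𝒜 f hf hm).fromSpec =
      Spec.map (Proj.awayToSection 𝒜 f) ≫ Proj.awayι 𝒜 f hf hm := by
    rw [← cancel_epi (Proj.isAffineOpen_basicOpen 𝒜 f hf hm).isoSpec.hom,
      ← Proj.basicOpenIsoSpec_inv_ι]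
    have : (Proj.isAffineOpen_basicOpen 𝒜 f hf hm).isoSpec.hom ≫
        Spec.map (Proj.awayToSection 𝒜 f) = (Proj.basicOpenIsoSpec 𝒜 f hf hm).hom := rfl
    rw [reassoc_of% this, Iso.hom_inv_id_assoc, IsAffineOpen.fromSpec, Iso.hom_inv_id_assoc]
  rw [h, Category.assoc, Proj.awayι_toSpecZero, ← Spec.map_comp]

instance : IsArtinianRing (grS 0) :=
  algebraMap_grS_zero_surjective.isArtinianRing

/-- A scheme finite over an Artinian base is discrete, so its open part over `U` is also closed. The
inclusion of that part is a closed immersion, and its composite with the finite structure morphism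
is finite. -/
lemma finite_quotient_of_isFinite_subscheme {X : Scheme.{0}} {B : CommRingCat.{0}}
    [IsArtinianRing B] (I : X.IdealSheafData) (q : X ⟶ Spec B) [IsFinite (I.subschemeι ≫ q)]
    (U : X.affineOpens) (φ : B ⟶ Γ(X, U.1)) (hφ : U.2.fromSpec ≫ q = Spec.map φ) :
    ((Ideal.Quotient.mk (I.ideal U)).comp φ.hom).Finite := by
  have : DiscreteTopology I.subscheme := by
    rw [← isDiscrete_univ_iff]
    have : DiscreteTopology (Spec B) := inferInstanceAs (DiscreteTopology (PrimeSpectrum B))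
    exact (I.subschemeι ≫ q).isDiscrete_preimage (s := Set.univ) (isDiscrete_univ_iff.2 this)
  let c : Spec (.of (Γ(X, U.1) ⧸ I.ideal U)) ⟶ I.subscheme := I.subschemeCover.f U
  have : IsOpenImmersion c := I.subschemeCover.map_prop U
  have : IsClosedImmersion c := .of_isPreimmersion _ (isClosed_discrete _)
  have hc : c ≫ I.subschemeι = Spec.map (CommRingCat.ofHom (Ideal.Quotient.mk (I.ideal U))) ≫
      U.2.fromSpec := (I.subschemeCover_map_subschemeι U).trans (I.glueDataObjι_ι U)
  have h : c ≫ I.subschemeι ≫ q =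
      Spec.map (CommRingCat.ofHom ((Ideal.Quotient.mk (I.ideal U)).comp φ.hom)) := by
    rw [reassoc_of% hc, hφ, ← Spec.map_comp]
    rfl
  have h1 : IsFinite (c ≫ I.subschemeι ≫ q) := inferInstance
  rwa [h, IsFinite.SpecMap_iff] at h1

lemma finite_mk_comp_chartConst {𝓘 : PThree.IdealSheafData} (hfin : HasFiniteColength 𝓘)
    (i : Fin 4) : ((Ideal.Quotient.mk (𝓘.ideal (chart i))).comp (chartConst i)).Finite := by
  have hfin' : IsFinite (𝓘.subschemeι ≫ Proj.toSpecZero grS) := hfin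
  have : IsArtinianRing (CommRingCat.of (grS 0)) := inferInstanceAs (IsArtinianRing (grS 0))
  exact finite_quotient_of_isFinite_subscheme 𝓘 (Proj.toSpecZero grS) (chart i)
    (CommRingCat.ofHom (HomogeneousLocalization.fromZeroRingHom grS (Submonoid.powers (X i))) ≫
      Proj.awayToSection grS (X i)) (fromSpec_toSpecZero grS (X_mem_grS i) one_pos)

/-- The chart ideal is a preimage, so its quotient embeds in the quotient of the ring of sections,
which is finite over the degree-0 constants and hence over ℝ. -/
lemma finiteDimensional_quot_chartIdeal {𝓘 : PThree.IdealSheafData} (hfin : HasFiniteColength 𝓘)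
    (i : Fin 4) : FiniteDimensional ℝ (R ⧸ chartIdeal 𝓘 i) := by
  let φ : R →+* Γ(PThree, (chart i).1) ⧸ 𝓘.ideal (chart i) :=
    (Ideal.Quotient.mk _).comp (chartCoord i)
  have hφ : RingHom.ker φ = chartIdeal 𝓘 i := by
    rw [← RingHom.comap_ker, Ideal.mk_ker]
    rfl
  have hC : φ.comp C = ((Ideal.Quotient.mk (𝓘.ideal (chart i))).comp (chartConst i)).comp
      (algebraMap ℝ (grS 0)) := by
    refine RingHom.ext fun x => ?_
    refine congrArg (fun z => Ideal.Quotient.mk (𝓘.ideal (chart i))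
      ((Proj.awayToSection grS (X i)).hom z)) ?_
    exact eval₂Hom_C _ _ x
  have hfinite : (φ.comp C).Finite := by
    rw [hC]
    exact (finite_mk_comp_chartConst hfin i).comp
      (RingHom.Finite.of_surjective _ algebraMap_grS_zero_surjective)
  algebraize [φ.comp C]
  have hφ' : ∀ r ∈ chartIdeal 𝓘 i, φ r = 0 := fun r hr => by rwa [← hφ] at hr
  let ψ : R ⧸ chartIdeal 𝓘 i →ₐ[ℝ] Γ(PThree, (chart i).1) ⧸ 𝓘.ideal (chart i) :=
    { __ := Ideal.Quotient.lift (chartIdeal 𝓘 i) φ hφ'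
      commutes' := fun r => rfl }
  have hψ : Function.Injective ψ :=
    RingHom.lift_injective_of_ker_le_ideal _ hφ' hφ.le
  exact FiniteDimensional.of_injective ψ.toLinearMap hψ

/-! ### Stability of the chart ideals under the torus -/

/-- By hypothesis a section of `I` pulls back to zero along the subscheme inclusion followed by `F`.
Its pullback by `F` thus vanishes on the subscheme, which is membership in `I`. -/
lemma appLE_mem_ideal_of_le_map {X : Scheme.{0}} {F : X ⟶ X} {I : X.IdealSheafData}
    (h : I ≤ I.map F) (U : X.affineOpens) (e : U.1 ≤ F ⁻¹ᵁ U.1) {x : Γ(X, U.1)}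
    (hx : x ∈ I.ideal U) : F.appLE U.1 U.1 e x ∈ I.ideal U := by
  have h1 : (I.subschemeι ≫ F).app U.1 x = 0 :=
    Scheme.Hom.ideal_ker_le (I.subschemeι ≫ F) U (h U hx)
  have he : I.subschemeι ⁻¹ᵁ U.1 ≤ (I.subschemeι ≫ F) ⁻¹ᵁ U.1 := fun _ hx => e hx
  have h2 : F.appLE U.1 U.1 e ≫ I.subschemeι.app U.1 = (I.subschemeι ≫ F).app U.1 ≫
      I.subscheme.presheaf.map (homOfLE he).op := by
    rw [Scheme.Hom.app_eq_appLE, Scheme.Hom.app_eq_appLE, Scheme.Hom.appLE_comp_appLE,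
      Scheme.Hom.appLE_map]
  rw [← I.ker_subschemeι_app, RingHom.mem_ker]
  have h3 := congrArg (fun f => f.hom x) h2
  refine h3.trans ?_
  change (I.subscheme.presheaf.map _).hom ((I.subschemeι ≫ F).app U.1 x) = 0
  rw [h1, map_zero]

/-- Pullback naturally lands in the localization at `f s`; the relation `s = f s * v` allows
restriction from there to the localization at `s`. For a diagonal substitution `v` is an inverse
scalar. -/
lemma awayToSection_comp_appLE_self {σ A : Type} [CommRing A] [SetLike σ A]
    [AddSubgroupClass σ A] {𝒜 : ℕ → σ} [GradedRing 𝒜] (f : 𝒜 →+*ᵍ 𝒜) (hf : 𝒜₊ ≤ 𝒜₊.map f)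
    {s : A} {n m : ℕ} (hs : s ∈ 𝒜 n) {v : A} (hv : v ∈ 𝒜 m) (hsv : s = f s * v)
    (e : Proj.basicOpen 𝒜 s ≤ Proj.map f hf ⁻¹ᵁ Proj.basicOpen 𝒜 s) :
    Proj.awayToSection 𝒜 s ≫ (Proj.map f hf).appLE (Proj.basicOpen 𝒜 s) (Proj.basicOpen 𝒜 s) e =
      CommRingCat.ofHom ((HomogeneousLocalization.awayMap 𝒜 hv hsv).comp
        (HomogeneousLocalization.Away.map f s)) ≫ Proj.awayToSection 𝒜 s := by
  rw [CommRingCat.ofHom_comp, Category.assoc, Proj.awayMap_awayToSection,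
    ← Proj.awayToSection_comp_appLE_assoc f hf hs, Scheme.Hom.appLE_map]

lemma awayMap_fromZero {σ A : Type} [CommRing A] [SetLike σ A]
    [AddSubgroupClass σ A] {𝒜 : ℕ → σ} [GradedRing 𝒜] (f : 𝒜 →+*ᵍ 𝒜) (s : A) (z : 𝒜 0)
    (hz : f z = z) : HomogeneousLocalization.Away.map f s
      (HomogeneousLocalization.fromZeroRingHom 𝒜 (Submonoid.powers s) z) =
        HomogeneousLocalization.fromZeroRingHom 𝒜 (Submonoid.powers (f s)) z := by
  refine HomogeneousLocalization.val_injective _ ?_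
  change Localization.mk (f z) ⟨f 1, _⟩ = Localization.mk (z : A) ⟨1, _⟩
  simp only [hz, map_one]

lemma C_mem_grS (r : ℝ) : (C r : MvPolynomial (Fin 4) ℝ) ∈ grS 0 := isHomogeneous_C (Fin 4) r

/-- The homomorphism from `R` to the homogeneous localization of the coordinate ring. -/
def awayCoord (i : Fin 4) : R →+* HomogeneousLocalization.Away grS (X i) :=
  eval₂Hom ((HomogeneousLocalization.fromZeroRingHom grS (Submonoid.powers (X i))).comp
    (algebraMap ℝ (grS 0))) fun j : Fin 3 => HomogeneousLocalization.Away.mk grS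
      (X_mem_grS i) 1 (X (i.succAbove j)) (X_mem_grS (i.succAbove j))

/-! ### The diagonal torus in homogeneous and chart coordinates. -/

section Diagonal

variable {a b : ℤ} (ha : Odd a) (hb : Odd b) (t : ℝˣ)

/-- The element `diag(t, t⁻¹)` of `N_S`. -/
def diagNS (t : ℝˣ) : NS := ⟨diagSL t, Subgroup.subset_closure (Or.inl ⟨t, rfl⟩)⟩

lemma repGL_diagNS : (repGL a b ha hb (diagNS t)).1 =
    Matrix.diagonal fun j => (t : ℝ) ^ homWeight a b j := by
  have ha0 : a ≠ 0 := by rintro rfl; simp at ha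
  have hb0 : b ≠ 0 := by rintro rfl; simp at hb
  change blockMatrix a b (diagSL t) = _
  ext i j
  fin_cases i <;> fin_cases j <;>
    simp [blockMatrix, diagSL, homWeight, zero_zpow _ ha0, zero_zpow _ hb0]

lemma linSubst_diagNS_X (j : Fin 4) : linSubst (repGL a b ha hb (diagNS t)).1 (X j) =
    C ((t : ℝ) ^ homWeight a b j) * X j := by
  rw [repGL_diagNS, linSubst_apply, aeval_X, Finset.sum_eq_single j]
  · rw [Matrix.diagonal_apply_eq]
  · intro i _ hij
    rw [Matrix.diagonal_apply_ne _ hij, C_0, zero_mul]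
  · simp

lemma linSubst_diagNS_X_mul (i : Fin 4) : X i =
    linSubst (repGL a b ha hb (diagNS t)).1 (X i) * C (((t : ℝ) ^ homWeight a b i)⁻¹) := by
  rw [linSubst_diagNS_X, mul_right_comm, ← C_mul, mul_inv_cancel₀ (zpow_ne_zero _ t.ne_zero), C_1,
    one_mul]

/-- The substitution sends X_j/X_i to t^{e_j}X_j/(t^{e_i}X_i), so the tangent weight e_j - e_i
appears; constants are fixed. -/
lemma awayMap_comp_awayCoord (i : Fin 4) :
    ((HomogeneousLocalization.awayMap grS (C_mem_grS (((t : ℝ) ^ homWeight a b i)⁻¹))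
      (linSubst_diagNS_X_mul ha hb t i)).comp (HomogeneousLocalization.Away.map
        (linSubst (repGL a b ha hb (diagNS t)).1) (X i))).comp (awayCoord i) =
      (awayCoord i).comp (torusAct (tangentWeight a b i) t : R →+* R) := by
  refine ringHom_ext (fun r => ?_) fun j => ?_
  · have h1 : awayCoord i (C r) = HomogeneousLocalization.fromZeroRingHom grS
        (Submonoid.powers (X i)) (algebraMap ℝ (grS 0) r) := eval₂Hom_C _ _ r
    have h2 : HomogeneousLocalization.Away.map (linSubst (repGL a b ha hb (diagNS t)).1) (X i)
        (awayCoord i (C r)) = HomogeneousLocalization.fromZeroRingHom grS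
          (Submonoid.powers (linSubst (repGL a b ha hb (diagNS t)).1 (X i)))
            (algebraMap ℝ (grS 0) r) := by
      rw [h1]
      refine awayMap_fromZero _ _ _ ?_
      exact (linSubst_apply _ _).trans (aeval_C _ r)
    have h3 : (torusAct (tangentWeight a b i) t : R →+* R) (C r) = C r :=
      (torusAct (tangentWeight a b i) t).commutes r
    rw [RingHom.comp_apply, RingHom.comp_apply, RingHom.comp_apply, h2, h3, h1,
      HomogeneousLocalization.awayMap_fromZeroRingHom]
  · have h1 : ∀ j, awayCoord i (X j) = HomogeneousLocalization.Away.mk grS (X_mem_grS i) 1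
        (X (i.succAbove j)) (X_mem_grS (i.succAbove j)) := fun j => eval₂Hom_X' _ _ j
    have h3 : (torusAct (tangentWeight a b i) t : R →+* R) (X j) =
      C ((t : ℝ) ^ tangentWeight a b i j) * X j := aeval_X _ j
    have h4 : awayCoord i (C ((t : ℝ) ^ tangentWeight a b i j)) =
      HomogeneousLocalization.fromZeroRingHom grS (Submonoid.powers (X i))
        (algebraMap ℝ (grS 0) ((t : ℝ) ^ tangentWeight a b i j)) := eval₂Hom_C _ _ _
    rw [RingHom.comp_apply, RingHom.comp_apply, RingHom.comp_apply, h1,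
      HomogeneousLocalization.Away.map_mk, HomogeneousLocalization.awayMap_mk, h3, map_mul, h1, h4]
    ext
    rw [HomogeneousLocalization.val_mul]
    simp only [HomogeneousLocalization.Away.val_mk]
    have h5 : (HomogeneousLocalization.fromZeroRingHom grS (Submonoid.powers (X i))
        (algebraMap ℝ (grS 0) ((t : ℝ) ^ tangentWeight a b i j))).val =
          Localization.mk (C ((t : ℝ) ^ tangentWeight a b i j)) 1 := rfl
    rw [h5, Localization.mk_mul, one_mul, linSubst_diagNS_X, pow_one, mul_right_comm, ← C_mul,
      tangentWeight, zpow_sub₀ t.ne_zero, div_eq_mul_inv]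

end Diagonal

/-- Stability is applied to diag(t, t⁻¹), which scales X_i by a unit and so preserves the chart;
pullback of functions there is `torusAct`. -/
lemma isTorusStable_chartIdeal {a b : ℤ} {ha : Odd a} {hb : Odd b} {𝓘 : PThree.IdealSheafData}
    (hst : IsNSStable a b ha hb 𝓘) (i : Fin 4) :
    IsTorusStable (tangentWeight a b i) (chartIdeal 𝓘 i) := by
  intro t r hr
  have h1 : 𝓘 ≤ 𝓘.map (projAut (repGL a b ha hb (diagNS t))) :=
    Scheme.IdealSheafData.le_map_iff_comap_le.2 (hst (diagNS t)).le
  have e : (chart i).1 ≤ projAut (repGL a b ha hb (diagNS t)) ⁻¹ᵁ (chart i).1 := by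
    change Proj.basicOpen grS (X i) ≤ Proj.basicOpen grS (linSubst _ (X i))
    refine Proj.basicOpen_mono _ _ _ ⟨_, linSubst_diagNS_X_mul ha hb t i⟩
  have h2 := appLE_mem_ideal_of_le_map h1 (chart i) e hr
  have h3 := awayToSection_comp_appLE_self (linSubst (repGL a b ha hb (diagNS t)).1)
    (irrelevant_le_map_linSubst _) (X_mem_grS i)
    (C_mem_grS (((t : ℝ) ^ homWeight a b i)⁻¹)) (linSubst_diagNS_X_mul ha hb t i) e
  have h4 := congrArg (fun f => f.hom (awayCoord i r)) h3
  have h5 := congrArg (fun f => (Proj.awayToSection grS (X i)).hom (f r))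
    (awayMap_comp_awayCoord ha hb t i)
  change chartCoord i (torusAct (tangentWeight a b i) t r) ∈ 𝓘.ideal (chart i)
  have h6 := h4.trans h5
  exact (congrArg (· ∈ 𝓘.ideal (chart i)) h6).mp h2

end NSTrace

end

open NSTrace in
theorem mainTheorem4 (a b : ℤ) (ha : Odd a) (hb : Odd b)
    (𝓘 : PThree.IdealSheafData) (hfin : HasFiniteColength 𝓘) (hst : IsNSStable a b ha hb 𝓘)
    (i : Fin 4) :
    ∃ hI : IsTorusStable (tangentWeight a b i) (chartIdeal 𝓘 i),
      IsFiniteTorusRep (quotAct hI) ∧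
      IsFiniteTorusRep (extAct hI 1) ∧
      IsFiniteTorusRep (extAct hI 2) ∧
      ∀ (s : Fin 3 → ℤ[T;T⁻¹]) (Q : ℤ[T;T⁻¹]),
        (∀ j, s j = LaurentPolynomial.T (tangentWeight a b i j)) →
        Q = tr (quotAct hI) →
        (tr (extAct hI 1) - tr (extAct hI 2) =
          (s 0 * s 1 * s 2 * Q - LaurentPolynomial.invert Q +
              Q * LaurentPolynomial.invert Q * ((1 - s 0) * (1 - s 1) * (1 - s 2))) *
            LaurentPolynomial.invert (s 0 * s 1 * s 2)) ∧
        (IsMonomial (chartIdeal 𝓘 i) →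
          (stdMonomials (chartIdeal 𝓘 i)).Finite ∧
          Q = ∑ᶠ m ∈ stdMonomials (chartIdeal 𝓘 i), s 0 ^ m 0 * s 1 ^ m 1 * s 2 ^ m 2) := by
  have := finiteDimensional_quot_chartIdeal hfin i
  have hI := isTorusStable_chartIdeal hst i
  exact ⟨hI, isFiniteTorusRep_quot hI, isFiniteTorusRep_extAct_one hI,
    isFiniteTorusRep_extAct_two hI, fun s Q hs hQ => ⟨tr_extAct_sub hI hs hQ, fun h =>
      ⟨h.finite_stdMonomials, hQ.trans (h.tr_quotAct hI hs)⟩⟩⟩
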